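/- Let $I \xleftarrow{s} E \xrightarrow{p} B \xrightarrow{t} I$ be a diagram of groupoids such that every homotopy fibre $E_b$ of $p$ is equivalent to a finite set, and let $P : \mathrm{Grpd}_{/I} \to \mathrm{Grpd}_{/I}$ be the associated polynomial endofunctor of the homotopy slice (the $2$-category of groupoids over $I$, with triangles commuting up to a specified natural isomorphism as $1$-cells). Explicitly, $P(X)$ has as objects the pairs $(b,f)$ with $b\in B$ and $f : E_b \to X$ a map over $I$ (where $E_b$ is over $I$ via $E_b \to E \xrightarrow{s} I$); its arrows $(b,f)\to(b',f')$ are an arrow $\beta : b \to b'$ with a $2$-cell $f \Rightarrow f'\circ\beta_!$ over $I$, where $\beta_! : E_b\to E_{b'}$ is the induced map; and it lies over $I$ via $(b,f)\mapsto t(b)$. A (finite rooted) tree is a diagram of finite sets $A \xleftarrow{s_T} M \xrightarrow{p_T} N \xrightarrow{t_T} A$ with $t_T$ injective, with $s_T$ injective with singleton complement (the root edge), and such that from every edge the walk $s_T(m)\mapsto t_T(p_T(m))$ reaches the root edge in finitely many steps. The leaves are the edges not in the image of $t_T$. A $P$-tree is a tree with maps $A \to I$, $M \to E$, $N \to B$,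 $A\to I$ (the first and the last being the same map) to the diagram of $P$, with specified isomorphisms filling the three squares, the middle square being a homotopy pullback; the arrows of the groupoid of $P$-trees are the isomorphisms of trees together with arrows between the decorations, compatible with the specified isomorphisms. A $P$-tree is dead if it has no leaves. The groupoid $D$ of dead $P$-trees is the full subgroupoid of the groupoid of $P$-trees on the dead ones; it lies over $I$ via the decoration of the root edge. A $P$-algebra is an object $X$ of $\mathrm{Grpd}_{/I}$ with a map $P(X)\to X$ over $I$; its homomorphisms are maps over $I$ with a specified invertible $2$-cell filling the square with the structure maps, and its $2$-cells are the compatible $2$-cells over $I$. A $P$-algebra is homotopy initial if its mapping groupoid to every $P$-algebra is contractible. **Proposition.** The fixpoint equation $X \simeq P(X)$ has a least solution, namely the groupoid $D$ of dead $P$-trees: there is a structure map $a : P(D) \to D$ over $I$ which is an equivalence of groupoids and for which $(D,a)$ is a homotopy initial $P$-algebra. -/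

import Mathlib

open CategoryTheory

universe u v w w' x x' y y'

noncomputable section

set_option linter.checkUnivs false

namespace GrpdPoly

/-! ### Homotopy slices of groupoids -/

/-- An object of the homotopy slice `Grpd_{/I}`: a groupoid with a functor to `I`. -/
structure Slice (I : Type u) [Groupoid.{v} I] where
  carrier : Type w
  [grpd : Groupoid.{w'} carrier]
  proj : carrier ⥤ I

attribute [instance] Slice.grpd

/-- A 1-cell of the homotopy slice: a triangle commuting up to a specified 2-cell.  The 2-cell is
a natural transformation between functors to a groupoid, hence invertible; it is given by its
components. -/
structure SliceHom {I : Type u} [Groupoid.{v} I]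
    (X : Slice.{u, v, w, w'} I) (Y : Slice.{u, v, x, x'} I) where
  functor : X.carrier ⥤ Y.carrier
  triangle : ∀ a : X.carrier, Y.proj.obj (functor.obj a) ⟶ X.proj.obj a
  natural : ∀ {a a' : X.carrier} (k : a ⟶ a'),
    Y.proj.map (functor.map k) ≫ triangle a' = triangle a ≫ X.proj.map k

/-- A 2-cell of the homotopy slice: a natural transformation (automatically invertible)
compatible with the 2-cells of the two triangles. -/
@[ext]
structure SliceTwoCell {I : Type u} [Groupoid.{v} I]
    {X : Slice.{u, v, w, w'} I} {Y : Slice.{u, v, x, x'} I} (F G : SliceHom X Y) where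
  trans : F.functor ⟶ G.functor
  compat : ∀ a : X.carrier, Y.proj.map (trans.app a) ≫ G.triangle a = F.triangle a

/-- The mapping groupoid of two objects of the slice. -/
instance SliceHom.category {I : Type u} [Groupoid.{v} I]
    {X : Slice.{u, v, w, w'} I} {Y : Slice.{u, v, x, x'} I} : Category (SliceHom X Y) where
  Hom F G := SliceTwoCell F G
  id F := { trans := 𝟙 _, compat := fun a => by simp }
  comp σ τ :=
    { trans := σ.trans ≫ τ.trans
      compat := fun a => by simp [τ.compat, σ.compat] }
  id_comp _ := SliceTwoCell.ext (Category.id_comp _)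
  comp_id _ := SliceTwoCell.ext (Category.comp_id _)
  assoc _ _ _ := SliceTwoCell.ext (Category.assoc _ _ _)

section
variable {I : Type u} [Groupoid.{v} I]
  {X : Slice.{u, v, w, w'} I} {Y : Slice.{u, v, x, x'} I} {Z : Slice.{u, v, y, y'} I}

/-- The underlying natural transformation of a 2-cell. -/
abbrev SliceHom.nat {F G : SliceHom X Y} (σ : F ⟶ G) : F.functor ⟶ G.functor :=
  SliceTwoCell.trans σ

@[simp]
theorem SliceHom.id_trans (F : SliceHom X Y) : SliceTwoCell.trans (𝟙 F) = 𝟙 F.functor := rfl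

@[simp]
theorem SliceHom.comp_trans {F G H : SliceHom X Y} (σ : F ⟶ G) (τ : G ⟶ H) :
    SliceTwoCell.trans (σ ≫ τ) = SliceHom.nat σ ≫ SliceHom.nat τ := rfl

theorem SliceHom.hom_ext {F G : SliceHom X Y} {σ τ : F ⟶ G}
    (h : ∀ a, (SliceHom.nat σ).app a = (SliceHom.nat τ).app a) : σ = τ :=
  SliceTwoCell.ext (NatTrans.ext (funext h))

/-- Composition of 1-cells of the slice. -/
@[simps]
def SliceHom.comp (F : SliceHom X Y) (G : SliceHom Y Z) : SliceHom X Z where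
  functor := F.functor ⋙ G.functor
  triangle a := G.triangle (F.functor.obj a) ≫ F.triangle a
  natural k := by
    have h := G.natural (F.functor.map k)
    simp [reassoc_of% h, F.natural]

/-- Whiskering of a 2-cell with a 1-cell before it. -/
@[simps]
def SliceHom.whiskerLeft (F : SliceHom X Y) {G G' : SliceHom Y Z} (τ : G ⟶ G') :
    F.comp G ⟶ F.comp G' where
  trans := Functor.whiskerLeft F.functor (SliceHom.nat τ)
  compat a := by
    change Z.proj.map ((SliceHom.nat τ).app (F.functor.obj a)) ≫
      G'.triangle (F.functor.obj a) ≫ F.triangle a = G.triangle (F.functor.obj a) ≫ F.triangle a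
    rw [← Category.assoc, SliceTwoCell.compat τ]

/-- Whiskering of a 2-cell with a 1-cell after it. -/
@[simps]
def SliceHom.whiskerRight {F F' : SliceHom X Y} (τ : F ⟶ F') (G : SliceHom Y Z) :
    F.comp G ⟶ F'.comp G where
  trans := Functor.whiskerRight (SliceHom.nat τ) G.functor
  compat a := by
    change Z.proj.map (G.functor.map ((SliceHom.nat τ).app a)) ≫
      G.triangle (F'.functor.obj a) ≫ F'.triangle a = G.triangle (F.functor.obj a) ≫ F.triangle a
    rw [← Category.assoc, G.natural, Category.assoc, SliceTwoCell.compat τ]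

theorem SliceHom.whiskerLeft_id (F : SliceHom X Y) (G : SliceHom Y Z) :
    F.whiskerLeft (𝟙 G) = 𝟙 (F.comp G) := rfl

theorem SliceHom.whiskerLeft_comp (F : SliceHom X Y) {G G' G'' : SliceHom Y Z}
    (σ : G ⟶ G') (τ : G' ⟶ G'') :
    F.whiskerLeft (σ ≫ τ) = F.whiskerLeft σ ≫ F.whiskerLeft τ := rfl

theorem SliceHom.whiskerRight_id (F : SliceHom X Y) (G : SliceHom Y Z) :
    SliceHom.whiskerRight (𝟙 F) G = 𝟙 (F.comp G) :=
  SliceHom.hom_ext fun _ => G.functor.map_id _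

theorem SliceHom.whiskerRight_comp {F F' F'' : SliceHom X Y} (σ : F ⟶ F') (τ : F' ⟶ F'')
    (G : SliceHom Y Z) : SliceHom.whiskerRight (σ ≫ τ) G =
      SliceHom.whiskerRight σ G ≫ SliceHom.whiskerRight τ G :=
  SliceHom.hom_ext fun _ => G.functor.map_comp _ _

end

/-! ### Polynomial endofunctors -/

/-- A polynomial `I ← E → B → I` of groupoids, representing an endofunctor of `Grpd_{/I}`. -/
structure PolyEndo (I : Type u) [Groupoid.{v} I] where
  E : Type u
  B : Type u
  [grpdE : Groupoid.{v} E]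
  [grpdB : Groupoid.{v} B]
  s : E ⥤ I
  p : E ⥤ B
  t : B ⥤ I

attribute [instance] PolyEndo.grpdE PolyEndo.grpdB

namespace PolyEndo

variable {I : Type u} [Groupoid.{v} I] (P : PolyEndo.{u, v} I)

/-- The homotopy fibre `E_b`, with objects the pairs `(e, φ : p e ⟶ b)`. -/
abbrev Fibre (b : P.B) := CostructuredArrow P.p b

/-- The functor `β_! : E_b ⥤ E_b'`, `(e, φ) ↦ (e, φ ≫ β)`. -/
abbrev fibreMap {b b' : P.B} (β : b ⟶ b') : P.Fibre b ⥤ P.Fibre b' := CostructuredArrow.map β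

/-- `p` has finite discrete fibres: every homotopy fibre is equivalent to a finite set. -/
def HasFiniteDiscreteFibres : Prop :=
  ∀ b : P.B, ∃ n : ℕ, Nonempty (P.Fibre b ≌ Discrete (Fin n))

/-- An object of `P(X)`: an operation `b` with a map `E_b → X` over `I`, the triangle commuting
up to a specified 2-cell (given by its components, automatically invertible). -/
structure EvalObj (X : Slice.{u, v, w, w'} I) where
  op : P.B
  dec : P.Fibre op ⥤ X.carrier
  triangle : ∀ e : P.Fibre op, X.proj.obj (dec.obj e) ⟶ P.s.obj e.left
  natural : ∀ {e e' : P.Fibre op} (k : e ⟶ e'),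
    X.proj.map (dec.map k) ≫ triangle e' = triangle e ≫ P.s.map k.left

variable {P}

/-- An arrow `(b, f) ⟶ (b', f')` of `P(X)`: an arrow `β : b ⟶ b'` of `B` with a 2-cell
`f ⟹ f' ∘ β_!` over `I` (given by its components, automatically invertible). -/
@[ext]
structure EvalHom {X : Slice.{u, v, w, w'} I} (S T : P.EvalObj X) where
  base : S.op ⟶ T.op
  cell : ∀ e : P.Fibre S.op, S.dec.obj e ⟶ T.dec.obj ((P.fibreMap base).obj e)
  natural : ∀ {e e' : P.Fibre S.op} (k : e ⟶ e'),
    S.dec.map k ≫ cell e' = cell e ≫ T.dec.map ((P.fibreMap base).map k)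
  compat : ∀ e : P.Fibre S.op,
    X.proj.map (cell e) ≫ T.triangle ((P.fibreMap base).obj e) = S.triangle e

section
variable {X : Slice.{u, v, w, w'} I}

/-- For `β = β'`, the canonical arrow between the images of an object under `β_!`, `β'_!`. -/
abbrev fibreCongr {b b' : P.B} {β β' : b ⟶ b'} (h : β = β') (e : P.Fibre b) :
    (P.fibreMap β).obj e ⟶ (P.fibreMap β').obj e :=
  CostructuredArrow.homMk (𝟙 e.left) (by simp [h])

/-- The canonical arrow from an object to its image under `(𝟙)_!`. -/
abbrev fibreMapId {b : P.B} (e : P.Fibre b) : e ⟶ (P.fibreMap (𝟙 b)).obj e :=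
  CostructuredArrow.homMk (𝟙 e.left)

/-- The canonical arrow from `β'_! β_! e` to `(β ≫ β')_! e`. -/
abbrev fibreMapComp {b b' b'' : P.B} (β : b ⟶ b') (β' : b' ⟶ b'') (e : P.Fibre b) :
    (P.fibreMap β').obj ((P.fibreMap β).obj e) ⟶ (P.fibreMap (β ≫ β')).obj e :=
  CostructuredArrow.homMk (𝟙 e.left)

/-- The canonical arrow from `e` to `β_! (β⁻¹)_! e`. -/
abbrev fibreMapInv {b b' : P.B} (β : b ⟶ b') (e : P.Fibre b') :
    e ⟶ (P.fibreMap β).obj ((P.fibreMap (Groupoid.inv β)).obj e) :=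
  CostructuredArrow.homMk (𝟙 e.left) (by simp)

theorem EvalHom.ext' {S T : P.EvalObj X} {g h : EvalHom S T} (hb : g.base = h.base)
    (hc : ∀ e, g.cell e ≫ T.dec.map (fibreCongr hb e) = h.cell e) : g = h := by
  obtain ⟨β, c, n, o⟩ := g
  obtain ⟨β', c', n', o'⟩ := h
  obtain rfl : β = β' := hb
  obtain rfl : c = c' := by
    funext e
    refine Eq.trans ?_ (hc e)
    exact ((congrArg (c e ≫ ·) (T.dec.map_id _)).trans (Category.comp_id _)).symm
  rfl

/-- The identity arrow of `P(X)`. -/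
@[simps]
def EvalHom.id (S : P.EvalObj X) : EvalHom S S where
  base := 𝟙 S.op
  cell e := S.dec.map (fibreMapId e)
  natural k := by
    rw [← Functor.map_comp, ← Functor.map_comp]
    congr 1
    ext
    simp
  compat e := by
    rw [S.natural]
    exact (congrArg (S.triangle e ≫ ·) (P.s.map_id _)).trans (Category.comp_id _)

/-- Composition in `P(X)`. -/
@[simps]
def EvalHom.comp {S T U : P.EvalObj X} (g : EvalHom S T) (h : EvalHom T U) : EvalHom S U where
  base := g.base ≫ h.base
  cell e := g.cell e ≫ h.cell ((P.fibreMap g.base).obj e) ≫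
    U.dec.map (fibreMapComp g.base h.base e)
  natural {e e'} k := by
    rw [reassoc_of% g.natural k, reassoc_of% h.natural ((P.fibreMap g.base).map k)]
    simp only [Category.assoc, ← Functor.map_comp]
    congr 3
    apply CostructuredArrow.hom_ext
    simp
  compat e := by
    rw [Functor.map_comp, Functor.map_comp, Category.assoc, Category.assoc, U.natural]
    refine Eq.trans ?_ (g.compat e)
    congr 1
    refine Eq.trans ?_ (h.compat _)
    congr 1
    exact (congrArg (U.triangle _ ≫ ·) (P.s.map_id _)).trans (Category.comp_id _)

/-- The inverse of an arrow of `P(X)`. -/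
@[simps]
def EvalHom.inv {S T : P.EvalObj X} (g : EvalHom S T) : EvalHom T S where
  base := Groupoid.inv g.base
  cell e := T.dec.map (fibreMapInv g.base e) ≫
    Groupoid.inv (g.cell ((P.fibreMap (Groupoid.inv g.base)).obj e))
  natural {e e'} k := by
    have h1 := g.natural ((P.fibreMap (Groupoid.inv g.base)).map k)
    rw [← Category.assoc, Groupoid.inv_eq_inv (g.cell _), Groupoid.inv_eq_inv (g.cell _),
      IsIso.comp_inv_eq, Category.assoc, Category.assoc, h1, IsIso.inv_hom_id_assoc]
    simp only [← Functor.map_comp]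
    congr 1
    apply CostructuredArrow.hom_ext
    simp
  compat e := by
    rw [← g.compat, ← Functor.map_comp_assoc, Category.assoc, Groupoid.inv_comp,
      Category.comp_id, T.natural]
    exact (congrArg (T.triangle _ ≫ ·) (P.s.map_id _)).trans (Category.comp_id _)

theorem EvalHom.id_comp' {S T : P.EvalObj X} (g : EvalHom S T) : (EvalHom.id S).comp g = g := by
  refine EvalHom.ext' (Category.id_comp _) fun e => ?_
  change (S.dec.map (fibreMapId e) ≫ g.cell ((P.fibreMap (𝟙 _)).obj e) ≫
    T.dec.map (fibreMapComp (𝟙 _) g.base e)) ≫ T.dec.map (fibreCongr (Category.id_comp _) e) = _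
  rw [Category.assoc, Category.assoc, reassoc_of% g.natural (fibreMapId e), ← Functor.map_comp,
    ← Functor.map_comp]
  refine Eq.trans ?_ (Category.comp_id _)
  congr 1
  rw [← T.dec.map_id]
  congr 1
  apply CostructuredArrow.hom_ext
  simp

theorem EvalHom.comp_id' {S T : P.EvalObj X} (g : EvalHom S T) : g.comp (EvalHom.id T) = g := by
  refine EvalHom.ext' (Category.comp_id _) fun e => ?_
  change (g.cell e ≫ T.dec.map (fibreMapId _) ≫ T.dec.map (fibreMapComp g.base (𝟙 _) e)) ≫
    T.dec.map (fibreCongr (Category.comp_id _) e) = _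
  rw [Category.assoc, ← Functor.map_comp, ← Functor.map_comp]
  refine Eq.trans ?_ (Category.comp_id _)
  congr 1
  rw [← T.dec.map_id]
  congr 1
  apply CostructuredArrow.hom_ext
  simp

theorem EvalHom.assoc' {S T U V : P.EvalObj X} (g : EvalHom S T) (h : EvalHom T U)
    (k : EvalHom U V) : (g.comp h).comp k = g.comp (h.comp k) := by
  refine EvalHom.ext' (Category.assoc _ _ _) fun e => ?_
  change ((g.cell e ≫ h.cell _ ≫ U.dec.map (fibreMapComp g.base h.base e)) ≫
    k.cell ((P.fibreMap (g.base ≫ h.base)).obj e) ≫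
      V.dec.map (fibreMapComp (g.base ≫ h.base) k.base e)) ≫
      V.dec.map (fibreCongr (Category.assoc _ _ _) e) =
    g.cell e ≫ (h.cell ((P.fibreMap g.base).obj e) ≫ k.cell _ ≫
      V.dec.map (fibreMapComp h.base k.base ((P.fibreMap g.base).obj e))) ≫
      V.dec.map (fibreMapComp g.base (h.base ≫ k.base) e)
  simp only [Category.assoc]
  rw [reassoc_of% k.natural (fibreMapComp g.base h.base e)]
  simp only [← Functor.map_comp]
  congr 4
  apply CostructuredArrow.hom_ext
  simp

theorem EvalHom.inv_comp' {S T : P.EvalObj X} (g : EvalHom S T) :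
    g.inv.comp g = EvalHom.id T := by
  refine EvalHom.ext' (Groupoid.inv_comp _) fun e => ?_
  change ((T.dec.map (fibreMapInv g.base e) ≫
      Groupoid.inv (g.cell ((P.fibreMap (Groupoid.inv g.base)).obj e))) ≫
      g.cell ((P.fibreMap (Groupoid.inv g.base)).obj e) ≫
      T.dec.map (fibreMapComp (Groupoid.inv g.base) g.base e)) ≫
      T.dec.map (fibreCongr (Groupoid.inv_comp _) e) = T.dec.map (fibreMapId e)
  simp only [Category.assoc]
  rw [← Category.assoc (Groupoid.inv _), Groupoid.inv_comp, Category.id_comp]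
  simp only [← Functor.map_comp]
  congr 1
  apply CostructuredArrow.hom_ext
  simp

theorem EvalHom.comp_inv' {S T : P.EvalObj X} (g : EvalHom S T) :
    g.comp g.inv = EvalHom.id S := by
  have h := EvalHom.inv_comp' g.inv
  calc g.comp g.inv = (EvalHom.id S).comp (g.comp g.inv) := (EvalHom.id_comp' _).symm
    _ = (g.inv.inv.comp g.inv).comp (g.comp g.inv) := by rw [h]
    _ = g.inv.inv.comp ((g.inv.comp g).comp g.inv) := by simp only [EvalHom.assoc']
    _ = EvalHom.id S := by rw [EvalHom.inv_comp', EvalHom.id_comp', h]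

/-- The groupoid `P(X)`. -/
instance EvalObj.groupoid (X : Slice.{u, v, w, w'} I) : Groupoid (P.EvalObj X) where
  Hom S T := EvalHom S T
  id S := EvalHom.id S
  comp g h := EvalHom.comp g h
  inv g := EvalHom.inv g
  id_comp := EvalHom.id_comp'
  comp_id := EvalHom.comp_id'
  assoc := EvalHom.assoc'
  inv_comp := EvalHom.inv_comp'
  comp_inv := EvalHom.comp_inv'

end

variable (P)

/-- The value of the polynomial functor on objects: `P(X)` over `I`, via `(b, f) ↦ t b`. -/
@[simps]
def obj (X : Slice.{u, v, w, w'} I) : Slice.{u, v, max u v w w', max u v w'} I where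
  carrier := P.EvalObj X
  proj :=
    { obj := fun S => P.t.obj S.op
      map := fun g => P.t.map (EvalHom.base g)
      map_id := fun S => P.t.map_id S.op
      map_comp := fun g h => P.t.map_comp (EvalHom.base g) (EvalHom.base h) }

section
variable {X : Slice.{u, v, w, w'} I} {Y : Slice.{u, v, x, x'} I}

/-- Postcomposition of a decoration with a 1-cell: `(b, f) ↦ (b, F ∘ f)`. -/
abbrev mapObj (F : SliceHom X Y) (S : P.EvalObj X) : P.EvalObj Y where
  op := S.op
  dec := S.dec ⋙ F.functor
  triangle e := F.triangle (S.dec.obj e) ≫ S.triangle e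
  natural k := by
    change Y.proj.map (F.functor.map (S.dec.map k)) ≫ F.triangle _ ≫ S.triangle _ = _
    rw [← Category.assoc, F.natural, Category.assoc, S.natural, Category.assoc]

/-- The action of `(b, f) ↦ (b, F ∘ f)` on arrows. -/
abbrev mapHom (F : SliceHom X Y) {S T : P.EvalObj X} (g : EvalHom S T) :
    EvalHom (P.mapObj F S) (P.mapObj F T) where
  base := g.base
  cell e := F.functor.map (g.cell e)
  natural {e e' : P.Fibre S.op} k := by
    change F.functor.map (S.dec.map k) ≫ F.functor.map _ =
      F.functor.map _ ≫ F.functor.map (T.dec.map _)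
    rw [← Functor.map_comp, ← Functor.map_comp, g.natural]
  compat (e : P.Fibre S.op) := by
    change Y.proj.map (F.functor.map (g.cell e)) ≫ F.triangle _ ≫ T.triangle _ =
      F.triangle _ ≫ S.triangle _
    rw [← Category.assoc, F.natural, Category.assoc, g.compat]

theorem mapHom_id (F : SliceHom X Y) (S : P.EvalObj X) :
    P.mapHom F (EvalHom.id S) = EvalHom.id (P.mapObj F S) := rfl

theorem mapHom_comp (F : SliceHom X Y) {S T U : P.EvalObj X} (g : EvalHom S T)
    (h : EvalHom T U) : P.mapHom F (g.comp h) = (P.mapHom F g).comp (P.mapHom F h) := by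
  refine EvalHom.ext rfl (heq_of_eq (funext fun (e : P.Fibre S.op) => ?_))
  change F.functor.map (g.cell e ≫ h.cell _ ≫ U.dec.map (fibreMapComp g.base h.base e)) =
    F.functor.map (g.cell e) ≫ F.functor.map (h.cell _) ≫ F.functor.map (U.dec.map _)
  rw [Functor.map_comp, Functor.map_comp]

/-- The value of the polynomial functor on 1-cells. -/
@[simps]
def map (F : SliceHom X Y) : SliceHom (P.obj X) (P.obj Y) where
  functor :=
    { obj := fun S => P.mapObj F S
      map := fun g => P.mapHom F g
      map_id := P.mapHom_id F
      map_comp := P.mapHom_comp F }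
  triangle S := 𝟙 (P.t.obj S.op)
  natural _ := (Category.comp_id _).trans (Category.id_comp _).symm

/-- The component of `P(τ)` at `(b, f)`: the identity of `b` with the whiskered 2-cell
`F ∘ f ⟹ G ∘ f`. -/
abbrev twoCell {F G : SliceHom X Y} (τ : F ⟶ G) (S : P.EvalObj X) :
    EvalHom (P.mapObj F S) (P.mapObj G S) where
  base := 𝟙 S.op
  cell e := (SliceHom.nat τ).app (S.dec.obj e) ≫ G.functor.map (S.dec.map (fibreMapId e))
  natural {e e' : P.Fibre S.op} k := by
    change F.functor.map (S.dec.map k) ≫ (SliceHom.nat τ).app _ ≫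
        G.functor.map (S.dec.map (fibreMapId e')) =
      ((SliceHom.nat τ).app _ ≫ G.functor.map (S.dec.map (fibreMapId e))) ≫
        G.functor.map (S.dec.map ((P.fibreMap (𝟙 S.op)).map k))
    rw [← Category.assoc, NatTrans.naturality, Category.assoc, Category.assoc]
    simp only [← Functor.map_comp]
    congr 2
    exact congrArg _ (CostructuredArrow.hom_ext _ _ (by simp))
  compat (e : P.Fibre S.op) := by
    change Y.proj.map ((SliceHom.nat τ).app _ ≫ G.functor.map (S.dec.map (fibreMapId e))) ≫
      G.triangle _ ≫ S.triangle _ = F.triangle _ ≫ S.triangle _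
    rw [Functor.map_comp, Category.assoc, ← Category.assoc (Y.proj.map (G.functor.map _)),
      G.natural, Category.assoc, S.natural, ← Category.assoc, SliceTwoCell.compat τ]
    congr 1
    exact (congrArg (S.triangle _ ≫ ·) (P.s.map_id _)).trans (Category.comp_id _)

theorem twoCell_naturality {F G : SliceHom X Y} (τ : F ⟶ G) {S T : P.EvalObj X}
    (g : EvalHom S T) :
    (P.mapHom F g).comp (P.twoCell τ T) = (P.twoCell τ S).comp (P.mapHom G g) := by
  refine EvalHom.ext' ((Category.comp_id _).trans (Category.id_comp _).symm)
    fun (e : P.Fibre S.op) => ?_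
  change (F.functor.map (g.cell e) ≫ ((SliceHom.nat τ).app _ ≫
      G.functor.map (T.dec.map (fibreMapId ((P.fibreMap g.base).obj e)))) ≫
      G.functor.map (T.dec.map (fibreMapComp g.base (𝟙 T.op) e))) ≫
      G.functor.map (T.dec.map (fibreCongr
        ((Category.comp_id g.base).trans (Category.id_comp g.base).symm) e)) =
    ((SliceHom.nat τ).app _ ≫ G.functor.map (S.dec.map (fibreMapId e))) ≫
      G.functor.map (g.cell ((P.fibreMap (𝟙 S.op)).obj e)) ≫
      G.functor.map (T.dec.map (fibreMapComp (𝟙 S.op) g.base e))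
  simp only [Category.assoc]
  rw [← Category.assoc (F.functor.map _), NatTrans.naturality, Category.assoc]
  simp only [← Functor.map_comp]
  rw [← Category.assoc (S.dec.map _), g.natural, Category.assoc]
  simp only [← Functor.map_comp]
  congr 4
  exact CostructuredArrow.hom_ext _ _ (by simp)

/-- The value of the polynomial functor on 2-cells. -/
@[simps]
def map₂ {F G : SliceHom X Y} (τ : F ⟶ G) : P.map F ⟶ P.map G where
  trans :=
    { app := fun S => P.twoCell τ S
      naturality := fun _ _ g => P.twoCell_naturality τ g }
  compat S := (congrArg (· ≫ 𝟙 _) (P.t.map_id (EvalObj.op S))).trans (Category.id_comp _)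

theorem map₂_id (F : SliceHom X Y) : P.map₂ (𝟙 F) = 𝟙 (P.map F) := by
  refine SliceHom.hom_ext fun S => EvalHom.ext rfl (heq_of_eq (funext fun e => ?_))
  exact Category.id_comp _

theorem twoCell_comp {F G H : SliceHom X Y} (σ : F ⟶ G) (τ : G ⟶ H) (S : P.EvalObj X) :
    P.twoCell (σ ≫ τ) S = (P.twoCell σ S).comp (P.twoCell τ S) := by
  refine EvalHom.ext' (Category.comp_id _).symm fun (e : P.Fibre S.op) => ?_
  change (((SliceHom.nat σ).app _ ≫ (SliceHom.nat τ).app _) ≫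
      H.functor.map (S.dec.map (fibreMapId e))) ≫
      H.functor.map (S.dec.map (fibreCongr (Category.comp_id (𝟙 S.op)).symm e)) =
    ((SliceHom.nat σ).app _ ≫ G.functor.map (S.dec.map (fibreMapId e))) ≫
      ((SliceHom.nat τ).app _ ≫ H.functor.map (S.dec.map (fibreMapId _))) ≫
      H.functor.map (S.dec.map (fibreMapComp (𝟙 S.op) (𝟙 S.op) e))
  simp only [Category.assoc]
  rw [← Category.assoc (G.functor.map _), NatTrans.naturality, Category.assoc]
  simp only [← Functor.map_comp]
  congr 4
  exact CostructuredArrow.hom_ext _ _ (by simp)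

theorem map₂_comp {F G H : SliceHom X Y} (σ : F ⟶ G) (τ : G ⟶ H) :
    P.map₂ (σ ≫ τ) = P.map₂ σ ≫ P.map₂ τ :=
  SliceHom.hom_ext fun S => P.twoCell_comp σ τ S

end
end PolyEndo

/-! ### Algebras -/

/-- A `P`-algebra: an object `X` of the slice with a 1-cell `P(X) → X`. -/
structure Alg {I : Type u} [Groupoid.{v} I] (P : PolyEndo.{u, v} I) where
  X : Slice.{u, v, w, w'} I
  str : SliceHom (P.obj X) X

section
variable {I : Type u} [Groupoid.{v} I] {P : PolyEndo.{u, v} I}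

/-- A homomorphism of `P`-algebras: a 1-cell with a specified invertible 2-cell filling the
square with sides the structure maps. -/
structure AlgHom (A : Alg.{u, v, w, w'} P) (C : Alg.{u, v, x, x'} P) where
  hom : SliceHom A.X C.X
  square : A.str.comp hom ≅ (P.map hom).comp C.str

/-- A 2-cell between homomorphisms of `P`-algebras: a 2-cell of the slice compatible with the
2-cells filling the two squares. -/
@[ext]
structure AlgTwoCell {A : Alg.{u, v, w, w'} P} {C : Alg.{u, v, x, x'} P} (F G : AlgHom A C) where
  cell : F.hom ⟶ G.hom
  compat : A.str.whiskerLeft cell ≫ G.square.hom =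
    F.square.hom ≫ SliceHom.whiskerRight (P.map₂ cell) C.str

/-- The mapping groupoid of two `P`-algebras. -/
instance AlgHom.category {A : Alg.{u, v, w, w'} P} {C : Alg.{u, v, x, x'} P} :
    Category (AlgHom A C) where
  Hom F G := AlgTwoCell F G
  id F :=
    { cell := 𝟙 _
      compat := by
        rw [P.map₂_id, SliceHom.whiskerLeft_id, SliceHom.whiskerRight_id, Category.id_comp,
          Category.comp_id] }
  comp σ τ :=
    { cell := σ.cell ≫ τ.cell
      compat := by
        rw [P.map₂_comp, SliceHom.whiskerLeft_comp, SliceHom.whiskerRight_comp, Category.assoc,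
          τ.compat, ← Category.assoc, σ.compat, Category.assoc] }
  id_comp _ := AlgTwoCell.ext (Category.id_comp _)
  comp_id _ := AlgTwoCell.ext (Category.comp_id _)
  assoc _ _ _ := AlgTwoCell.ext (Category.assoc _ _ _)

/-- `A` is homotopy initial among the algebras living in universes `x`, `x'`: every mapping
groupoid out of `A` is contractible, i.e. equivalent to a singleton. -/
def Alg.IsHomotopyInitial (A : Alg.{u, v, w, w'} P) : Prop :=
  ∀ C : Alg.{u, v, x, x'} P, Nonempty (AlgHom A C ≌ Discrete PUnit.{1})

/-- `A` solves the equation `X ≃ P(X)`: its structure map is an equivalence of groupoids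
over `I`. -/
def Alg.IsFixpoint (A : Alg.{u, v, w, w'} P) : Prop := A.str.functor.IsEquivalence

end

/-! ### Trees -/

open Classical in
/-- The walk-to-the-root function: an input edge `s m` goes to the output edge `t (p m)` of the
node it enters, and an edge which is not an input edge stays. -/
def walk {A M N : Type} (s : M → A) (p : M → N) (t : N → A) (a : A) : A :=
  if h : ∃ m, s m = a then t (p h.choose) else a

/-- A finite rooted tree `A ← M → N → A`: `A` is the set of edges, `N` the set of nodes, `M` the
set of nodes with a marked input edge. -/
structure Tree where
  A : Type
  M : Type
  N : Type
  [finA : Finite A]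
  [finM : Finite M]
  [finN : Finite N]
  s : M → A
  p : M → N
  t : N → A
  root : A
  t_injective : Function.Injective t
  s_injective : Function.Injective s
  compl_range_s : (Set.range s)ᶜ = {root}
  walk_to_root : ∀ a : A, ∃ k : ℕ, (walk s p t)^[k] a = root

attribute [instance] Tree.finA Tree.finM Tree.finN

/-- The leaves of a tree: the edges which are not the output edge of a node. -/
def Tree.leaves (T : Tree) : Set T.A := (Set.range T.t)ᶜ

section
variable {I : Type u} [Groupoid.{v} I] (P : PolyEndo.{u, v} I)

/-- A `P`-tree: a tree with decorations of its edges in `I`, of `M` in `E` and of its nodes in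
`B`, with specified isomorphisms filling the three squares, the middle one being a homotopy
pullback. -/
structure PTree where
  tree : Tree
  edge : tree.A → I
  mark : tree.M → P.E
  node : tree.N → P.B
  isoS : ∀ m, P.s.obj (mark m) ⟶ edge (tree.s m)
  isoP : ∀ m, P.p.obj (mark m) ⟶ node (tree.p m)
  isoT : ∀ n, P.t.obj (node n) ⟶ edge (tree.t n)
  pullback : (Discrete.functor fun m : tree.M =>
    (⟨mark m, ⟨tree.p m⟩, isoP m⟩ :
      Comma P.p (Discrete.functor node))).IsEquivalence

variable {P}

/-- An isomorphism of `P`-trees: an isomorphism of the underlying trees, with arrows between the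
decorations compatible with the specified isomorphisms of the squares. -/
structure PTreeHom (S T : PTree P) where
  fA : S.tree.A ≃ T.tree.A
  fM : S.tree.M ≃ T.tree.M
  fN : S.tree.N ≃ T.tree.N
  comm_s : ∀ m, fA (S.tree.s m) = T.tree.s (fM m)
  comm_p : ∀ m, fN (S.tree.p m) = T.tree.p (fM m)
  comm_t : ∀ n, fA (S.tree.t n) = T.tree.t (fN n)
  cellA : ∀ a, S.edge a ⟶ T.edge (fA a)
  cellM : ∀ m, S.mark m ⟶ T.mark (fM m)
  cellN : ∀ n, S.node n ⟶ T.node (fN n)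
  compat_s : ∀ m, S.isoS m ≫ cellA (S.tree.s m) ≫ eqToHom (congrArg T.edge (comm_s m)) =
    P.s.map (cellM m) ≫ T.isoS (fM m)
  compat_p : ∀ m, S.isoP m ≫ cellN (S.tree.p m) ≫ eqToHom (congrArg T.node (comm_p m)) =
    P.p.map (cellM m) ≫ T.isoP (fM m)
  compat_t : ∀ n, S.isoT n ≫ cellA (S.tree.t n) ≫ eqToHom (congrArg T.edge (comm_t n)) =
    P.t.map (cellN n) ≫ T.isoT (fN n)

namespace PTreeHom

/-- Transport of a family of arrows along an equality of indices. -/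
theorem cell_congr {C : Type*} [Category C] {α β : Type*} {x : α → C} {y : β → C} {f : α → β}
    (c : ∀ a, x a ⟶ y (f a)) {a a' : α} (h : a = a') :
    c a ≫ eqToHom (congrArg (fun z => y (f z)) h) = eqToHom (congrArg x h) ≫ c a' := by
  subst h
  simp

theorem square_comp {C D : Type*} [Category C] [Category D] (K : C ⥤ D) {x₀ x₁ x₂ : C}
    {y₀ y₁ y₁' y₂ y₂' y₂'' : D} {i₀ : K.obj x₀ ⟶ y₀} {i₁ : K.obj x₁ ⟶ y₁'}
    {i₂ : K.obj x₂ ⟶ y₂''} {a : y₀ ⟶ y₁} {b : y₁ ⟶ y₂} {b' : y₁' ⟶ y₂'} {c : x₀ ⟶ x₁}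
    {d : x₁ ⟶ x₂} {e₁ : y₁ = y₁'} {e₂ : y₂ = y₂'} {e₃ : y₂' = y₂''}
    (hb : b ≫ eqToHom e₂ = eqToHom e₁ ≫ b') (h₁ : i₀ ≫ a ≫ eqToHom e₁ = K.map c ≫ i₁)
    (h₂ : i₁ ≫ b' ≫ eqToHom e₃ = K.map d ≫ i₂) :
    i₀ ≫ (a ≫ b) ≫ eqToHom (e₂.trans e₃) = K.map (c ≫ d) ≫ i₂ := by
  subst e₁ e₂ e₃
  simp only [eqToHom_refl, Category.comp_id, Category.id_comp] at *
  subst hb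
  rw [← Category.assoc, h₁, Category.assoc, h₂, Functor.map_comp, Category.assoc]

theorem square_inv {C D : Type*} [Groupoid C] [Groupoid D] (K : C ⥤ D) {x₀ x₁ x₁' : C}
    {y₀ ya z₀ z₁ z₁' za : D} {i₀ : K.obj x₀ ⟶ y₀} {i₁ : K.obj x₁ ⟶ z₁} {i₁' : K.obj x₁' ⟶ z₁'}
    {c : x₀ ⟶ x₁} {d : y₀ ⟶ z₀} {d' : ya ⟶ za} {e₁ : z₀ = z₁} {ex : x₁' = x₁} {ez : z₁' = z₁}
    {ea : ya = y₀} {eza : za = z₀} {ez' : z₁' = za}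
    (h : i₀ ≫ d ≫ eqToHom e₁ = K.map c ≫ i₁)
    (hi : i₁' ≫ eqToHom ez = eqToHom (congrArg K.obj ex) ≫ i₁)
    (hd : d' ≫ eqToHom eza = eqToHom ea ≫ d) :
    i₁' ≫ (eqToHom ez' ≫ Groupoid.inv d') ≫ eqToHom ea =
      K.map (eqToHom ex ≫ Groupoid.inv c) ≫ i₀ := by
  subst e₁ ex ez ea eza
  simp only [eqToHom_refl, Category.comp_id, Category.id_comp] at *
  subst hi hd
  rw [Groupoid.inv_eq_inv, Groupoid.inv_eq_inv, IsIso.comp_inv_eq, Category.assoc, h,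
    Functor.map_inv, IsIso.inv_hom_id_assoc]

theorem ext' {S T : PTree P} {g h : PTreeHom S T}
    (hA : g.fA = h.fA) (hM : g.fM = h.fM) (hN : g.fN = h.fN)
    (cA : ∀ a, g.cellA a ≫ eqToHom (by rw [hA]) = h.cellA a)
    (cM : ∀ m, g.cellM m ≫ eqToHom (by rw [hM]) = h.cellM m)
    (cN : ∀ n, g.cellN n ≫ eqToHom (by rw [hN]) = h.cellN n) : g = h := by
  obtain ⟨fA, fM, fN, _, _, _, a, m, n, _, _, _⟩ := g
  obtain ⟨fA', fM', fN', _, _, _, a', m', n', _, _, _⟩ := h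
  obtain rfl : fA = fA' := hA
  obtain rfl : fM = fM' := hM
  obtain rfl : fN = fN' := hN
  obtain rfl : a = a' := funext fun z => (Category.comp_id _).symm.trans (cA z)
  obtain rfl : m = m' := funext fun z => (Category.comp_id _).symm.trans (cM z)
  obtain rfl : n = n' := funext fun z => (Category.comp_id _).symm.trans (cN z)
  rfl

/-- The identity of a `P`-tree. -/
@[simps]
def id (S : PTree P) : PTreeHom S S where
  fA := Equiv.refl _
  fM := Equiv.refl _
  fN := Equiv.refl _
  comm_s _ := rfl
  comm_p _ := rfl
  comm_t _ := rfl
  cellA a := 𝟙 (S.edge a)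
  cellM m := 𝟙 (S.mark m)
  cellN n := 𝟙 (S.node n)
  compat_s m := by simp
  compat_p m := by simp
  compat_t n := by simp

/-- Composition of isomorphisms of `P`-trees. -/
@[simps]
def comp {S T U : PTree P} (g : PTreeHom S T) (h : PTreeHom T U) : PTreeHom S U where
  fA := g.fA.trans h.fA
  fM := g.fM.trans h.fM
  fN := g.fN.trans h.fN
  comm_s m := (congrArg h.fA (g.comm_s m)).trans (h.comm_s _)
  comm_p m := (congrArg h.fN (g.comm_p m)).trans (h.comm_p _)
  comm_t n := (congrArg h.fA (g.comm_t n)).trans (h.comm_t _)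
  cellA a := g.cellA a ≫ h.cellA (g.fA a)
  cellM m := g.cellM m ≫ h.cellM (g.fM m)
  cellN n := g.cellN n ≫ h.cellN (g.fN n)
  compat_s m := square_comp P.s (cell_congr h.cellA (g.comm_s m)) (g.compat_s m) (h.compat_s _)
  compat_p m := square_comp P.p (cell_congr h.cellN (g.comm_p m)) (g.compat_p m) (h.compat_p _)
  compat_t n := square_comp P.t (cell_congr h.cellA (g.comm_t n)) (g.compat_t n) (h.compat_t _)

/-- The inverse of an isomorphism of `P`-trees. -/
@[simps]
def inv {S T : PTree P} (g : PTreeHom S T) : PTreeHom T S where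
  fA := g.fA.symm
  fM := g.fM.symm
  fN := g.fN.symm
  comm_s m := by rw [Equiv.symm_apply_eq, g.comm_s, Equiv.apply_symm_apply]
  comm_p m := by rw [Equiv.symm_apply_eq, g.comm_p, Equiv.apply_symm_apply]
  comm_t n := by rw [Equiv.symm_apply_eq, g.comm_t, Equiv.apply_symm_apply]
  cellA a := eqToHom (by rw [Equiv.apply_symm_apply]) ≫ Groupoid.inv (g.cellA (g.fA.symm a))
  cellM m := eqToHom (by rw [Equiv.apply_symm_apply]) ≫ Groupoid.inv (g.cellM (g.fM.symm m))
  cellN n := eqToHom (by rw [Equiv.apply_symm_apply]) ≫ Groupoid.inv (g.cellN (g.fN.symm n))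
  compat_s m := square_inv P.s (g.compat_s (g.fM.symm m))
    (cell_congr T.isoS (g.fM.apply_symm_apply m).symm)
    (cell_congr g.cellA (by rw [Equiv.symm_apply_eq, g.comm_s, Equiv.apply_symm_apply]))
  compat_p m := square_inv P.p (g.compat_p (g.fM.symm m))
    (cell_congr T.isoP (g.fM.apply_symm_apply m).symm)
    (cell_congr g.cellN (by rw [Equiv.symm_apply_eq, g.comm_p, Equiv.apply_symm_apply]))
  compat_t n := square_inv P.t (g.compat_t (g.fN.symm n))
    (cell_congr T.isoT (g.fN.apply_symm_apply n).symm)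
    (cell_congr g.cellA (by rw [Equiv.symm_apply_eq, g.comm_t, Equiv.apply_symm_apply]))

theorem id_comp' {S T : PTree P} (g : PTreeHom S T) : (id S).comp g = g :=
  ext' rfl rfl rfl (fun _ => (Category.comp_id _).trans (Category.id_comp _))
    (fun _ => (Category.comp_id _).trans (Category.id_comp _))
    (fun _ => (Category.comp_id _).trans (Category.id_comp _))

theorem comp_id' {S T : PTree P} (g : PTreeHom S T) : g.comp (id T) = g :=
  ext' rfl rfl rfl (fun _ => (Category.comp_id _).trans (Category.comp_id _))
    (fun _ => (Category.comp_id _).trans (Category.comp_id _))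
    (fun _ => (Category.comp_id _).trans (Category.comp_id _))

theorem assoc' {S T U V : PTree P} (g : PTreeHom S T) (h : PTreeHom T U) (k : PTreeHom U V) :
    (g.comp h).comp k = g.comp (h.comp k) :=
  ext' rfl rfl rfl (fun _ => (Category.comp_id _).trans (Category.assoc _ _ _))
    (fun _ => (Category.comp_id _).trans (Category.assoc _ _ _))
    (fun _ => (Category.comp_id _).trans (Category.assoc _ _ _))

theorem inv_comp' {S T : PTree P} (g : PTreeHom S T) : g.inv.comp g = id T := by
  refine ext' g.fA.symm_trans_self g.fM.symm_trans_self g.fN.symm_trans_self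
    (fun a => ?_) (fun m => ?_) (fun n => ?_)
  · change ((eqToHom _ ≫ Groupoid.inv _) ≫ g.cellA (g.fA.symm a)) ≫ eqToHom _ = 𝟙 _
    rw [Category.assoc (eqToHom _), Groupoid.inv_comp, Category.comp_id]
    exact eqToHom_trans _ _
  · change ((eqToHom _ ≫ Groupoid.inv _) ≫ g.cellM (g.fM.symm m)) ≫ eqToHom _ = 𝟙 _
    rw [Category.assoc (eqToHom _), Groupoid.inv_comp, Category.comp_id]
    exact eqToHom_trans _ _
  · change ((eqToHom _ ≫ Groupoid.inv _) ≫ g.cellN (g.fN.symm n)) ≫ eqToHom _ = 𝟙 _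
    rw [Category.assoc (eqToHom _), Groupoid.inv_comp, Category.comp_id]
    exact eqToHom_trans _ _

theorem comp_inv' {S T : PTree P} (g : PTreeHom S T) : g.comp g.inv = id S := by
  have h := inv_comp' g.inv
  calc g.comp g.inv = (id S).comp (g.comp g.inv) := (id_comp' _).symm
    _ = (g.inv.inv.comp g.inv).comp (g.comp g.inv) := by rw [h]
    _ = g.inv.inv.comp ((g.inv.comp g).comp g.inv) := by simp only [assoc']
    _ = id S := by rw [inv_comp', id_comp', h]

theorem map_root {S T : PTree P} (g : PTreeHom S T) : g.fA S.tree.root = T.tree.root := by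
  by_contra hne
  have h : g.fA S.tree.root ∉ (Set.range T.tree.s)ᶜ := by
    rw [T.tree.compl_range_s]
    exact hne
  obtain ⟨m, hm⟩ := Set.notMem_compl_iff.mp h
  have hr : S.tree.root ∈ (Set.range S.tree.s)ᶜ := by
    rw [S.tree.compl_range_s]
    rfl
  refine hr ⟨g.fM.symm m, g.fA.injective ?_⟩
  rw [g.comm_s, Equiv.apply_symm_apply, hm]

end PTreeHom

/-- The groupoid of `P`-trees. -/
instance PTree.groupoid : Groupoid (PTree P) where
  Hom S T := PTreeHom S T
  id S := PTreeHom.id S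
  comp g h := PTreeHom.comp g h
  inv g := PTreeHom.inv g
  id_comp := PTreeHom.id_comp'
  comp_id := PTreeHom.comp_id'
  assoc := PTreeHom.assoc'
  inv_comp := PTreeHom.inv_comp'
  comp_inv := PTreeHom.comp_inv'

variable (P)

/-- The map from the groupoid of `P`-trees to `I` given by the decoration of the root edge. -/
@[simps]
def rootColour : PTree P ⥤ I where
  obj T := T.edge T.tree.root
  map {_ T} g := PTreeHom.cellA g _ ≫ eqToHom (congrArg T.edge (PTreeHom.map_root g))
  map_id T := by
    change 𝟙 _ ≫ eqToHom _ = 𝟙 _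
    simp
  map_comp {S T U} g h := by
    have := PTreeHom.cell_congr (PTreeHom.cellA h) (PTreeHom.map_root g)
    change (PTreeHom.cellA g _ ≫ PTreeHom.cellA h _) ≫ eqToHom _ =
      (PTreeHom.cellA g _ ≫ eqToHom _) ≫ PTreeHom.cellA h _ ≫ eqToHom _
    rw [Category.assoc, Category.assoc, ← Category.assoc (eqToHom _), ← this, Category.assoc,
      eqToHom_trans]

/-- A dead `P`-tree: a `P`-tree without leaves. -/
def IsDead : ObjectProperty (PTree P) := fun T => T.tree.leaves = ∅

/-- Dead `P`-trees form a full subgroupoid of the groupoid of `P`-trees. -/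
instance deadGroupoid : Groupoid (IsDead P).FullSubcategory :=
  Groupoid.ofFullyFaithfulToGroupoid (IsDead P).ι (IsDead P).fullyFaithfulι

/-- The groupoid of dead `P`-trees, over `I` via the decoration of the root edge. -/
@[simps]
def deadTrees : Slice.{u, v, max u v 1, v} I where
  carrier := (IsDead P).FullSubcategory
  proj := (IsDead P).ι ⋙ rootColour P

end
end GrpdPoly

end

/-! A dead tree has a node at its root, because the root edge is not a leaf. Cutting this node off
leaves an operation `b` of `P` together with one dead tree for each input in `E_b`, that is, an
object of `P(D)`. This decomposition is a coalgebra `unglue : D → P(D)` over `I`, and the structure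
map of the theorem is its inverse. Two facts about it carry the proof.

It is an equivalence (`isEquivalence_unglue`). Faithfulness holds because every node is either the
root node or lies above an input. The rest comes from grafting. As `E_b` is equivalent to a finite
set, it has finitely many representatives, each object of the fibre having a single arrow to a
single representative. Grafting the trees at the representatives onto a new root node gives a finite
tree, through whose decomposition every arrow from the given object of `P(D)` to a decomposition
factors (`exists_universal_grafting`). Fullness and essential surjectivity follow formally.

It is well-founded (`exists_level_unglue`), since the subtrees have fewer nodes than the tree. For
any well-founded coalgebra `d` and any algebra `c`, the equation `F ≅ c ∘ P(F) ∘ d` has a solution,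
unique up to a unique compatible 2-cell. The solution is built on the objects of height less than
`n` by induction on `n`, and the stages are glued along their canonical comparisons;
`exists_solution_cell` and `solution_cell_unique` give the uniqueness. When `d` is an equivalence,
the solutions are the algebra homomorphisms out of `d⁻¹`, whence `isHomotopyInitial_inverse`.

Decorated trees are handled through the elements `El f x`, pairs of an index `i` and an arrow `x ⟶ f
i`. Equality of such pairs absorbs the transports between decorations, and the homotopy pullback
condition becomes bijectivity of a map of sets. -/

noncomputable section

namespace GrpdPoly

open PolyEndo

/-! ### Partially defined 1-cells -/

section
variable {I : Type u} [Groupoid.{v} I]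

/-- A 1-cell of the slice defined on the full subgroupoid of the objects satisfying `Q`. -/
structure PartialHom (X : Slice.{u, v, w, w'} I) (Y : Slice.{u, v, x, x'} I)
    (Q : X.carrier → Prop) where
  obj : ∀ T, Q T → Y.carrier
  map : ∀ {T T'} (h : Q T) (h' : Q T') (_ : T ⟶ T'), obj T h ⟶ obj T' h'
  map_id : ∀ T (h : Q T), map h h (𝟙 T) = 𝟙 _
  map_comp : ∀ {T T' T''} (h : Q T) (h' : Q T') (h'' : Q T'') (g : T ⟶ T') (g' : T' ⟶ T''),
    map h h'' (g ≫ g') = map h h' g ≫ map h' h'' g'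
  triangle : ∀ T h, Y.proj.obj (obj T h) ⟶ X.proj.obj T
  natural : ∀ {T T'} (h : Q T) (h' : Q T') (g : T ⟶ T'),
    Y.proj.map (map h h' g) ≫ triangle T' h' = triangle T h ≫ X.proj.map g

/-- A 2-cell between partially defined 1-cells, on the intersection of their domains. -/
@[ext]
structure PartialCell {X : Slice.{u, v, w, w'} I} {Y : Slice.{u, v, x, x'} I}
    {Q R : X.carrier → Prop} (F : PartialHom X Y Q) (G : PartialHom X Y R) where
  app : ∀ T (h : Q T) (h' : R T), F.obj T h ⟶ G.obj T h'
  naturality : ∀ {T T'} (g : T ⟶ T') (h : Q T) (k : R T) (h' : Q T') (k' : R T'),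
    F.map h h' g ≫ app T' h' k' = app T h k ≫ G.map k k' g
  compat : ∀ T h h', Y.proj.map (app T h h') ≫ G.triangle T h' = F.triangle T h

/-- A 1-cell, as an everywhere defined partial 1-cell. -/
def SliceHom.toPartial {X : Slice.{u, v, w, w'} I} {Y : Slice.{u, v, x, x'} I}
    (F : SliceHom X Y) : PartialHom X Y fun _ => True where
  obj T _ := F.functor.obj T
  map _ _ g := F.functor.map g
  map_id T _ := F.functor.map_id T
  map_comp _ _ _ g g' := F.functor.map_comp g g'
  triangle T _ := F.triangle T
  natural _ _ g := F.natural g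

/-- A 2-cell, as a 2-cell between partial 1-cells. -/
def SliceHom.toPartialCell {X : Slice.{u, v, w, w'} I} {Y : Slice.{u, v, x, x'} I}
    {F G : SliceHom X Y} (τ : F ⟶ G) : PartialCell F.toPartial G.toPartial where
  app T _ _ := (SliceHom.nat τ).app T
  naturality g _ _ _ _ := (SliceHom.nat τ).naturality g
  compat T _ _ := SliceTwoCell.compat τ T

/-- An everywhere defined partial 1-cell, as a 1-cell. -/
def PartialHom.toHom {X : Slice.{u, v, w, w'} I} {Y : Slice.{u, v, x, x'} I}
    (F : PartialHom X Y fun _ => True) : SliceHom X Y where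
  functor :=
    { obj := fun T => F.obj T trivial
      map := fun g => F.map trivial trivial g
      map_id := fun T => F.map_id T trivial
      map_comp := fun g g' => F.map_comp trivial trivial trivial g g' }
  triangle T := F.triangle T trivial
  natural g := F.natural trivial trivial g

/-! ### The polynomial functor on partially defined 1-cells -/

variable {P : PolyEndo.{u, v} I} {X : Slice.{u, v, w, w'} I} {Y : Slice.{u, v, x, x'} I}
  {Q R : X.carrier → Prop}

namespace PartialHom

/-- Postcomposition of a decoration with a partial 1-cell. -/
abbrev mapObj (F : PartialHom X Y Q) (S : P.EvalObj X) (hS : ∀ e, Q (S.dec.obj e)) :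
    P.EvalObj Y where
  op := S.op
  dec :=
    { obj := fun e => F.obj (S.dec.obj e) (hS e)
      map := fun k => F.map _ _ (S.dec.map k)
      map_id := fun e => by rw [S.dec.map_id, F.map_id]
      map_comp := fun k k' => by rw [S.dec.map_comp, F.map_comp] }
  triangle e := F.triangle (S.dec.obj e) (hS e) ≫ S.triangle e
  natural k := by
    change Y.proj.map (F.map _ _ (S.dec.map k)) ≫ F.triangle _ _ ≫ S.triangle _ = _
    rw [← Category.assoc, F.natural, Category.assoc, S.natural, Category.assoc]

/-- The action of `mapObj` on arrows. -/
abbrev mapHom (F : PartialHom X Y Q) {S T : P.EvalObj X} (hS : ∀ e, Q (S.dec.obj e))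
    (hT : ∀ e, Q (T.dec.obj e)) (g : EvalHom S T) : EvalHom (F.mapObj S hS) (F.mapObj T hT) where
  base := g.base
  cell e := F.map (hS e) (hT _) (g.cell e)
  natural {e e' : P.Fibre S.op} k := by
    change F.map _ _ (S.dec.map k) ≫ F.map _ _ _ = F.map _ _ _ ≫ F.map _ _ (T.dec.map _)
    rw [← F.map_comp, ← F.map_comp, g.natural]
  compat (e : P.Fibre S.op) := by
    change Y.proj.map (F.map _ _ (g.cell e)) ≫ F.triangle _ _ ≫ T.triangle _ =
      F.triangle _ _ ≫ S.triangle _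
    rw [← Category.assoc, F.natural, Category.assoc, g.compat]

theorem mapHom_comp (F : PartialHom X Y Q) {S T U : P.EvalObj X} (hS : ∀ e, Q (S.dec.obj e))
    (hT : ∀ e, Q (T.dec.obj e)) (hU : ∀ e, Q (U.dec.obj e)) (g : EvalHom S T)
    (h : EvalHom T U) : F.mapHom hS hU (g.comp h) = (F.mapHom hS hT g).comp (F.mapHom hT hU h) := by
  refine EvalHom.ext rfl (heq_of_eq (funext fun (e : P.Fibre S.op) => ?_))
  exact (F.map_comp (hS e) (hT _) (hU _) _ _).trans
    (congrArg (F.map (hS e) (hT _) (g.cell e) ≫ ·) (F.map_comp (hT _) (hU _) (hU _) _ _))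

end PartialHom

namespace PartialCell

variable {F : PartialHom X Y Q} {G : PartialHom X Y R}

/-- The component of the polynomial functor applied to a 2-cell of partial 1-cells. -/
abbrev map (τ : PartialCell F G) (S : P.EvalObj X) (hS : ∀ e, Q (S.dec.obj e))
    (kS : ∀ e, R (S.dec.obj e)) : EvalHom (F.mapObj S hS) (G.mapObj S kS) where
  base := 𝟙 S.op
  cell e := τ.app (S.dec.obj e) (hS e) (kS e) ≫ G.map _ _ (S.dec.map (fibreMapId e))
  natural {e e' : P.Fibre S.op} k := by
    change F.map _ _ (S.dec.map k) ≫ τ.app _ _ _ ≫ G.map _ _ (S.dec.map (fibreMapId e')) =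
      (τ.app _ _ _ ≫ G.map _ _ (S.dec.map (fibreMapId e))) ≫
        G.map _ _ (S.dec.map ((P.fibreMap (𝟙 S.op)).map k))
    rw [← Category.assoc, τ.naturality _ _ (kS e), Category.assoc, Category.assoc]
    rw [← G.map_comp, ← G.map_comp]
    simp only [← Functor.map_comp]
    congr 2
    exact congrArg _ (CostructuredArrow.hom_ext _ _ (by simp))
  compat (e : P.Fibre S.op) := by
    change Y.proj.map (τ.app _ _ _ ≫ G.map _ _ (S.dec.map (fibreMapId e))) ≫
      G.triangle _ _ ≫ S.triangle _ = F.triangle _ _ ≫ S.triangle _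
    rw [Functor.map_comp, Category.assoc, ← Category.assoc (Y.proj.map (G.map _ _ _)),
      G.natural, Category.assoc, S.natural, ← Category.assoc, τ.compat]
    congr 1
    exact (congrArg (S.triangle e ≫ ·) (P.s.map_id _)).trans (Category.comp_id _)

/-- The two composites have bases `β ≫ 𝟙` and `𝟙 ≫ β`, so the cells are compared along the arrow
between the two images in the fibre. Naturality of `τ` and of `g` reduces the claim to an equality
of arrows of the fibre, all with identity underlying arrow in `E`. -/
theorem map_naturality (τ : PartialCell F G) {S T : P.EvalObj X} (hS : ∀ e, Q (S.dec.obj e))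
    (kS : ∀ e, R (S.dec.obj e)) (hT : ∀ e, Q (T.dec.obj e)) (kT : ∀ e, R (T.dec.obj e))
    (g : EvalHom S T) :
    (F.mapHom hS hT g).comp (τ.map T hT kT) = (τ.map S hS kS).comp (G.mapHom kS kT g) := by
  refine EvalHom.ext' ((Category.comp_id _).trans (Category.id_comp _).symm)
    fun (e : P.Fibre S.op) => ?_
  change (F.map (hS e) (hT _) (g.cell e) ≫ (τ.app _ (hT _) (kT _) ≫
      G.map (kT _) (kT _) (T.dec.map (fibreMapId ((P.fibreMap g.base).obj e)))) ≫
      G.map (kT _) (kT _) (T.dec.map (fibreMapComp g.base (𝟙 T.op) e))) ≫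
      G.map (kT _) (kT ((P.fibreMap (𝟙 S.op ≫ g.base)).obj e)) (T.dec.map (fibreCongr
        ((Category.comp_id g.base).trans (Category.id_comp g.base).symm) e)) =
    (τ.app _ (hS e) (kS e) ≫ G.map (kS e) (kS _) (S.dec.map (fibreMapId e))) ≫
      G.map (kS _) (kT _) (g.cell ((P.fibreMap (𝟙 S.op)).obj e)) ≫
      G.map (kT _) (kT ((P.fibreMap (𝟙 S.op ≫ g.base)).obj e))
        (T.dec.map (fibreMapComp (𝟙 S.op) g.base e))
  simp only [Category.assoc]
  rw [← Category.assoc (F.map _ _ _), τ.naturality _ _ (kS e), Category.assoc]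
  rw [← G.map_comp, ← G.map_comp, ← G.map_comp, ← G.map_comp, ← G.map_comp]
  congr 2
  rw [← Category.assoc (S.dec.map _), g.natural, Category.assoc]
  simp only [← Functor.map_comp]
  congr 2
  exact CostructuredArrow.hom_ext _ _ (by simp)

/-- Composition of the components of 2-cells of partial 1-cells. -/
theorem map_comp {R' : X.carrier → Prop} {H : PartialHom X Y R'} (σ : PartialCell F G)
    (τ : PartialCell G H) (ρ : PartialCell F H) (S : P.EvalObj X) (hS : ∀ e, Q (S.dec.obj e))
    (kS : ∀ e, R (S.dec.obj e)) (lS : ∀ e, R' (S.dec.obj e))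
    (h : ∀ e, σ.app _ (hS e) (kS e) ≫ τ.app _ (kS e) (lS e) = ρ.app _ (hS e) (lS e)) :
    (σ.map S hS kS).comp (τ.map S kS lS) = ρ.map S hS lS := by
  refine EvalHom.ext' (Category.comp_id _) fun (e : P.Fibre S.op) => ?_
  change ((σ.app _ (hS e) (kS e) ≫ G.map (kS e) (kS _) (S.dec.map (fibreMapId e))) ≫
      (τ.app _ (kS _) (lS _) ≫ H.map (lS _) (lS _) (S.dec.map (fibreMapId _))) ≫
      H.map (lS _) (lS _) (S.dec.map (fibreMapComp (𝟙 S.op) (𝟙 S.op) e))) ≫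
      H.map (lS _) (lS ((P.fibreMap (𝟙 S.op)).obj e))
        (S.dec.map (fibreCongr (Category.comp_id (𝟙 S.op)) e)) =
    ρ.app _ (hS e) (lS e) ≫ H.map (lS e) (lS _) (S.dec.map (fibreMapId e))
  rw [← h e]
  simp only [Category.assoc]
  rw [← Category.assoc (G.map _ _ _), τ.naturality _ _ (lS e), Category.assoc]
  rw [← H.map_comp, ← H.map_comp, ← H.map_comp]
  simp only [← Functor.map_comp]
  congr 4
  exact CostructuredArrow.hom_ext _ _ (by simp)

end PartialCell
end

/-! ### Recursion along a well-founded coalgebra -/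

section
variable {I : Type u} [Groupoid.{v} I] {P : PolyEndo.{u, v} I} {X : Slice.{u, v, w, w'} I}
  (d : SliceHom X (P.obj X))

/-- The value of a coalgebra at an object. -/
abbrev parts (T : X.carrier) : P.EvalObj X := d.functor.obj T

/-- The value of a coalgebra at an arrow. -/
abbrev partsMap {T T' : X.carrier} (g : T ⟶ T') : EvalHom (parts d T) (parts d T') :=
  d.functor.map g

/-- The 2-cell of the triangle of a coalgebra. -/
abbrev partsTriangle (T : X.carrier) : P.t.obj (parts d T).op ⟶ X.proj.obj T := d.triangle T

theorem partsMap_id (T : X.carrier) : partsMap d (𝟙 T) = EvalHom.id _ := d.functor.map_id T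

theorem partsMap_comp {T T' T'' : X.carrier} (g : T ⟶ T') (g' : T' ⟶ T'') :
    partsMap d (g ≫ g') = (partsMap d g).comp (partsMap d g') := d.functor.map_comp g g'

theorem partsTriangle_natural {T T' : X.carrier} (g : T ⟶ T') :
    P.t.map (partsMap d g).base ≫ partsTriangle d T' = partsTriangle d T ≫ X.proj.map g :=
  d.natural g

/-- The value of the structure map of an algebra at an object. -/
abbrev glueObj (c : SliceHom (P.obj X) X) (S : P.EvalObj X) : X.carrier := c.functor.obj S

/-- The value of the structure map of an algebra at an arrow. -/
abbrev glueMap (c : SliceHom (P.obj X) X) {S T : P.EvalObj X} (g : EvalHom S T) :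
    glueObj c S ⟶ glueObj c T := c.functor.map g

/-- The 2-cell of the triangle of the structure map of an algebra. -/
abbrev glueTriangle (c : SliceHom (P.obj X) X) (S : P.EvalObj X) :
    X.proj.obj (glueObj c S) ⟶ P.t.obj S.op := c.triangle S

theorem glueMap_id (c : SliceHom (P.obj X) X) (S : P.EvalObj X) :
    glueMap c (EvalHom.id S) = 𝟙 _ := c.functor.map_id S

theorem glueMap_comp (c : SliceHom (P.obj X) X) {S T U : P.EvalObj X} (g : EvalHom S T)
    (h : EvalHom T U) : glueMap c (g.comp h) = glueMap c g ≫ glueMap c h :=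
  c.functor.map_comp (X := S) (Y := T) (Z := U) g h

theorem glueTriangle_natural (c : SliceHom (P.obj X) X) {S T : P.EvalObj X} (g : EvalHom S T) :
    X.proj.map (glueMap c g) ≫ glueTriangle c T = glueTriangle c S ≫ P.t.map g.base :=
  c.natural (a := S) (a' := T) g

/-- The objects all of whose immediate parts along the coalgebra `d` satisfy `Q`. -/
def Next (Q : X.carrier → Prop) (T : X.carrier) : Prop :=
  ∀ e, Q ((parts d T).dec.obj e)

/-- The objects of height less than `n` with respect to the coalgebra `d`. -/
def Level : ℕ → X.carrier → Prop
  | 0 => fun _ => False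
  | n + 1 => Next d (Level n)

variable {d}

theorem Level.succ {n : ℕ} {T : X.carrier} (h : Level d n T) : Level d (n + 1) T := by
  induction n generalizing T with
  | zero => exact h.elim
  | succ n ih => exact fun e => ih (h e)

/-- Height is invariant under isomorphism: the cells of the inverse arrow connect each part of `T'`
to a part of `T`. -/
theorem Level.of_hom {n : ℕ} {T T' : X.carrier} (g : T ⟶ T') (h : Level d n T) :
    Level d n T' := by
  induction n generalizing T T' with
  | zero => exact h.elim
  | succ n ih =>
    intro e
    exact ih (Groupoid.inv ((partsMap d (Groupoid.inv g)).cell e)) (h _)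

variable {C : Slice.{u, v, x, x'} I} (c : SliceHom (P.obj C) C) {Q R R' : X.carrier → Prop}

/-- The composite `c ∘ P(F) ∘ d`. -/
def PartialHom.step (F : PartialHom X C Q) : PartialHom X C (Next d Q) where
  obj T h := glueObj c (F.mapObj (parts d T) h)
  map h h' g := glueMap c (F.mapHom h h' (partsMap d g))
  map_id T h := by
    rw [partsMap_id]
    exact glueMap_id c _
  map_comp h h' h'' g g' := by
    rw [partsMap_comp, ← glueMap_comp, F.mapHom_comp h h' h'']
  triangle T h := glueTriangle c (F.mapObj (parts d T) h) ≫ partsTriangle d T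
  natural h h' g := by
    rw [← Category.assoc, glueTriangle_natural, Category.assoc, Category.assoc,
      partsTriangle_natural]

/-- The 2-cell `c ∘ P(τ) ∘ d`. -/
def PartialCell.step {F : PartialHom X C Q} {G : PartialHom X C R} (τ : PartialCell F G) :
    PartialCell (F.step (d := d) c) (G.step (d := d) c) where
  app T h h' := glueMap c (τ.map (parts d T) h h')
  naturality g h k h' k' := by
    change glueMap c _ ≫ glueMap c _ = glueMap c _ ≫ glueMap c _
    rw [← glueMap_comp, ← glueMap_comp, τ.map_naturality h k h' k' (partsMap d g)]
  compat T h h' := by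
    change C.proj.map (glueMap c _) ≫ glueTriangle c (G.mapObj (parts d T) h') ≫
      partsTriangle d T = glueTriangle c (F.mapObj (parts d T) h) ≫ partsTriangle d T
    rw [← Category.assoc, glueTriangle_natural]
    congr 1
    exact (congrArg (glueTriangle c _ ≫ ·) (P.t.map_id _)).trans (Category.comp_id _)

/-- The hypothesis concerns only the immediate parts of `T`. In this pointwise form it is exactly
what an induction on the height supplies. -/
theorem PartialCell.step_comp {F : PartialHom X C Q} {G : PartialHom X C R}
    {H : PartialHom X C R'} (σ : PartialCell F G) (τ : PartialCell G H) (ρ : PartialCell F H)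
    (T : X.carrier) (h : Next d Q T) (k : Next d R T) (l : Next d R' T)
    (hc : ∀ e, σ.app _ (h e) (k e) ≫ τ.app _ (k e) (l e) = ρ.app _ (h e) (l e)) :
    (σ.step c).app T h k ≫ (τ.step c).app T k l = (ρ.step (d := d) c).app T h l := by
  change glueMap c _ ≫ glueMap c _ = glueMap c _
  rw [← glueMap_comp, PartialCell.map_comp σ τ ρ _ h k l hc]

/-- The composite of a 2-cell with the inverse of a 2-cell. -/
def PartialCell.compInv {F : PartialHom X C Q} {G : PartialHom X C R} {H : PartialHom X C R'}
    (σ : PartialCell F H) (θ : PartialCell G H) (r : ∀ T, R T → R' T) : PartialCell F G where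
  app T h k := σ.app T h (r T k) ≫ Groupoid.inv (θ.app T k (r T k))
  naturality {T T'} g h k h' k' := by
    have h1 := σ.naturality g h (r T k) h' (r T' k')
    have h2 := θ.naturality g k (r T k) k' (r T' k')
    rw [← Category.assoc, h1, Category.assoc, Category.assoc]
    congr 1
    rw [Groupoid.inv_eq_inv, Groupoid.inv_eq_inv, IsIso.comp_inv_eq, Category.assoc, h2,
      IsIso.inv_hom_id_assoc]
  compat T h k := by
    rw [Functor.map_comp, Category.assoc, ← θ.compat T k (r T k),
      ← Category.assoc (C.proj.map (Groupoid.inv _)), ← Functor.map_comp, Groupoid.inv_comp,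
      CategoryTheory.Functor.map_id, Category.id_comp, σ.compat]

/-! ### Approximate solutions on objects of bounded height -/

variable (d)

/-- The solution of the recursion equation on the objects of height less than `n`. -/
def approx : ∀ n : ℕ, PartialHom X C (Level d n)
  -- No object has height less than `0`, so the first stage is the empty 1-cell.
  | 0 =>
    { obj := fun _ h => h.elim
      map := fun h => h.elim
      map_id := fun _ h => h.elim
      map_comp := fun h => h.elim
      triangle := fun _ h => h.elim
      natural := fun h => h.elim }
  | n + 1 => (approx n).step c

/-- The comparison of two approximate solutions. -/
def approxCell : ∀ n m : ℕ, PartialCell (approx d c n) (approx d c m)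
  | 0, _ =>
    { app := fun _ h => h.elim
      naturality := fun _ h => h.elim
      compat := fun _ h => h.elim }
  | _ + 1, 0 =>
    { app := fun _ _ h => h.elim
      naturality := fun _ _ h => h.elim
      compat := fun _ _ h => h.elim }
  | n + 1, m + 1 => (approxCell n m).step c

/-- This cocycle condition is what allows the stages to be glued. The three indices decrease
together, and a step of 2-cells is determined by the values on the parts. -/
theorem approxCell_comp (n m k : ℕ) (T : X.carrier) (h : Level d n T) (h' : Level d m T)
    (h'' : Level d k T) : (approxCell d c n m).app T h h' ≫ (approxCell d c m k).app T h' h'' =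
      (approxCell d c n k).app T h h'' := by
  induction n generalizing m k T with
  | zero => exact h.elim
  | succ n ih =>
    cases m with
    | zero => exact h'.elim
    | succ m =>
      cases k with
      | zero => exact h''.elim
      | succ k => exact PartialCell.step_comp c _ _ _ T h h' h'' fun e => ih m k _ _ _ _

/-- By the cocycle condition this endomorphism is idempotent, and an idempotent of a groupoid is an
identity. -/
theorem approxCell_self (n : ℕ) (T : X.carrier) (h : Level d n T) :
    (approxCell d c n n).app T h h = 𝟙 _ := by
  rw [← cancel_mono ((approxCell d c n n).app T h h), approxCell_comp, Category.id_comp]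

/-! ### Gluing the approximations to a solution -/

variable {d}
variable (hd : ∀ T, ∃ n, Level d n T)

/-- The solution of the recursion equation. -/
def limit : PartialHom X C fun _ => True where
  obj T _ := (approx d c (hd T).choose).obj T (hd T).choose_spec
  -- The bounds chosen at `T` and `T'` need not agree. The arrow is mapped at the bound of `T`,
  -- which also bounds `T'` by invariance, and a comparison cell then changes to the bound of `T'`.
  map {T T'} _ _ g := (approx d c (hd T).choose).map (hd T).choose_spec
    ((hd T).choose_spec.of_hom g) g ≫ (approxCell d c _ _).app T' _ (hd T').choose_spec
  map_id T _ := by rw [PartialHom.map_id, Category.id_comp, approxCell_self]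
  map_comp {T T' T''} _ _ _ g g' := by
    rw [PartialHom.map_comp _ _ ((hd T).choose_spec.of_hom g), Category.assoc, Category.assoc,
      ← Category.assoc (PartialCell.app _ T' _ _),
      ← (approxCell d c _ _).naturality g' _ _
        (((hd T).choose_spec.of_hom g).of_hom g') ((hd T').choose_spec.of_hom g'),
      Category.assoc, approxCell_comp]
  triangle T _ := (approx d c (hd T).choose).triangle T (hd T).choose_spec
  natural {T T'} _ _ g := by
    rw [Functor.map_comp, Category.assoc, PartialCell.compat, PartialHom.natural]

/-- The comparison of an approximate solution with the solution. -/
def limitCell (n : ℕ) : PartialCell (approx d c n) (limit c hd) where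
  app T h _ := (approxCell d c n (hd T).choose).app T h (hd T).choose_spec
  naturality {T T'} g h _ h' _ := by
    change (approx d c n).map h h' g ≫ (approxCell d c n _).app T' h' (hd T').choose_spec =
      (approxCell d c n _).app T h (hd T).choose_spec ≫ (approx d c (hd T).choose).map _
        ((hd T).choose_spec.of_hom g) g ≫ (approxCell d c _ _).app T' _ (hd T').choose_spec
    rw [← Category.assoc, ← (approxCell d c _ _).naturality g h _ h' ((hd T).choose_spec.of_hom g),
      Category.assoc, approxCell_comp]
  compat T _ _ := PartialCell.compat _ T _ _

theorem approxCell_comp_limitCell (n m : ℕ) (T : X.carrier) (h : Level d n T) (h' : Level d m T) :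
    (approxCell d c n m).app T h h' ≫ (limitCell c hd m).app T h' trivial =
      (limitCell c hd n).app T h trivial :=
  approxCell_comp d c _ _ _ T _ _ _

/-- The component at `T` of the 2-cell exhibiting `limit` as a solution. -/
def limitFixApp (T : X.carrier) : (limit c hd).obj T trivial ⟶
    ((limit c hd).step (d := d) c).obj T fun _ => trivial :=
  -- The bound is raised by one because the stage `n + 1` is by definition the step of the stage
  -- `n`, to which the step of `limitCell` applies.
  (approxCell d c (hd T).choose ((hd T).choose + 1)).app T (hd T).choose_spec
    (hd T).choose_spec.succ ≫
      ((limitCell c hd (hd T).choose).step c).app T (hd T).choose_spec.succ fun _ => trivial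

/-- Frees `limitFixApp` from the chosen bound: seen from any positive stage that contains `T`, it is
the step of `limitCell`. -/
theorem limitCell_comp_limitFixApp (n : ℕ) (T : X.carrier) (h : Level d (n + 1) T) :
    (limitCell c hd (n + 1)).app T h trivial ≫ limitFixApp c hd T =
      ((limitCell c hd n).step c).app T h fun _ => trivial := by
  refine (Category.assoc _ _ _).symm.trans ?_
  refine (congrArg (· ≫ _) (approxCell_comp d c _ _ _ T h (hd T).choose_spec
    (hd T).choose_spec.succ)).trans ?_
  exact PartialCell.step_comp c _ _ _ T _ _ _ fun e => approxCell_comp_limitCell c hd _ _ _ _ _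

/-- The 2-cell exhibiting `limit` as a solution of the recursion equation. -/
def limitFix : PartialCell (limit c hd) ((limit c hd).step (d := d) c) where
  app T _ _ := limitFixApp c hd T
  naturality {T T'} g _ _ _ _ := by
    -- One bound serves both ends of `g`. After composition with the invertible `limitCell` at this
    -- stage, the claim is the naturality of a step.
    obtain ⟨n, hn⟩ : ∃ n, Level d (n + 1) T := ⟨_, (hd T).choose_spec.succ⟩
    rw [← cancel_epi ((limitCell c hd (n + 1)).app T hn trivial), ← Category.assoc,
      ← (limitCell c hd (n + 1)).naturality g hn trivial (hn.of_hom g) trivial, Category.assoc,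
      limitCell_comp_limitFixApp, ← Category.assoc, limitCell_comp_limitFixApp]
    exact PartialCell.naturality _ _ _ _ _ _
  compat T _ _ := by
    change C.proj.map ((approxCell d c (hd T).choose ((hd T).choose + 1)).app T _ _ ≫ _) ≫ _ = _
    refine (congrArg (· ≫ _) (C.proj.map_comp _ _)).trans ((Category.assoc _ _ _).trans ?_)
    refine (congrArg (_ ≫ ·) (PartialCell.compat _ T _ _)).trans ?_
    exact PartialCell.compat _ T _ _

/-! ### Uniqueness of the solution up to a unique 2-cell -/

variable {c}

/-- The comparison of an approximate solution with an arbitrary solution. -/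
def solutionCell {F : PartialHom X C fun _ => True}
    (θ : PartialCell F (F.step (d := d) c)) : ∀ n, PartialCell (approx d c n) F
  | 0 =>
    { app := fun _ h => h.elim
      naturality := fun _ h => h.elim
      compat := fun _ h => h.elim }
  -- From the stage `n + 1`, which is the step of the stage `n`, to the step of `F`, and back to `F`
  -- along the inverse of `θ`.
  | n + 1 => ((solutionCell θ n).step c).compInv θ fun _ _ _ => trivial

theorem solutionCell_succ {F : PartialHom X C fun _ => True}
    (θ : PartialCell F (F.step (d := d) c)) (n : ℕ) (T : X.carrier) (h : Level d (n + 1) T) :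
    (solutionCell θ (n + 1)).app T h trivial ≫ θ.app T trivial (fun _ => trivial) =
      ((solutionCell θ n).step c).app T h fun _ => trivial := by
  refine (Category.assoc _ _ _).trans ?_
  exact (congrArg (_ ≫ ·) (Groupoid.inv_comp _)).trans (Category.comp_id _)

theorem approxCell_comp_solutionCell {F : PartialHom X C fun _ => True}
    (θ : PartialCell F (F.step (d := d) c)) (n m : ℕ) (T : X.carrier) (h : Level d n T)
    (h' : Level d m T) :
    (approxCell d c n m).app T h h' ≫ (solutionCell θ m).app T h' trivial =
      (solutionCell θ n).app T h trivial := by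
  induction n generalizing m T with
  | zero => exact h.elim
  | succ n ih =>
    cases m with
    | zero => exact h'.elim
    | succ m =>
      rw [← cancel_mono (θ.app T trivial fun _ => trivial), Category.assoc, solutionCell_succ,
        solutionCell_succ]
      exact PartialCell.step_comp c _ _ _ T _ _ _ fun e => ih m _ _ _

/-- A compatible 2-cell must carry the canonical cells of `F` to those of `G`. As these cells are
invertible, its value at every object is forced. -/
theorem solutionCell_comp {F G : PartialHom X C fun _ => True}
    (θ : PartialCell F (F.step (d := d) c)) (θ' : PartialCell G (G.step (d := d) c))
    (τ : PartialCell F G)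
    (hτ : ∀ T, τ.app T trivial trivial ≫ θ'.app T trivial (fun _ => trivial) =
      θ.app T trivial (fun _ => trivial) ≫ (τ.step c).app T (fun _ => trivial) fun _ => trivial)
    (n : ℕ) (T : X.carrier) (h : Level d n T) :
    (solutionCell θ n).app T h trivial ≫ τ.app T trivial trivial =
      (solutionCell θ' n).app T h trivial := by
  induction n generalizing T with
  | zero => exact h.elim
  | succ n ih =>
    rw [← cancel_mono (θ'.app T trivial fun _ => trivial), Category.assoc, solutionCell_succ,
      hτ, ← Category.assoc, solutionCell_succ]
    exact PartialCell.step_comp c _ _ _ T _ _ _ fun e => ih _ _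

include hd

theorem exists_solution_cell {F G : PartialHom X C fun _ => True}
    (θ : PartialCell F (F.step (d := d) c)) (θ' : PartialCell G (G.step (d := d) c)) :
    ∃ τ : PartialCell F G,
      ∀ T, τ.app T trivial trivial ≫ θ'.app T trivial (fun _ => trivial) =
        θ.app T trivial (fun _ => trivial) ≫
          (τ.step c).app T (fun _ => trivial) fun _ => trivial := by
  -- The only possible value, by `solutionCell_comp`.
  let t : ∀ T, F.obj T trivial ⟶ G.obj T trivial := fun T =>
    Groupoid.inv ((solutionCell θ (hd T).choose).app T (hd T).choose_spec trivial) ≫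
      (solutionCell θ' (hd T).choose).app T (hd T).choose_spec trivial
  -- The value does not depend on the bound used to define it, so each condition below may be
  -- checked at any convenient stage, where it can be tested after cancelling an invertible cell.
  have ht : ∀ n T (h : Level d n T), (solutionCell θ n).app T h trivial ≫ t T =
      (solutionCell θ' n).app T h trivial := by
    intro n T h
    rw [← approxCell_comp_solutionCell θ n _ T h (hd T).choose_spec,
      ← approxCell_comp_solutionCell θ' n _ T h (hd T).choose_spec, Category.assoc]
    congr 1
    rw [← Category.assoc, Groupoid.comp_inv, Category.id_comp]
  refine ⟨⟨fun T _ _ => t T, fun {T T'} g _ _ _ _ => ?_, fun T _ _ => ?_⟩, fun T => ?_⟩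
  · obtain ⟨n, hn⟩ := hd T
    rw [← cancel_epi ((solutionCell θ n).app T hn trivial), ← Category.assoc,
      ← (solutionCell θ n).naturality g hn trivial (hn.of_hom g) trivial, Category.assoc, ht,
      ← Category.assoc, ht, (solutionCell θ' n).naturality g hn trivial (hn.of_hom g) trivial]
  · obtain ⟨n, hn⟩ := hd T
    rw [← cancel_epi (C.proj.map ((solutionCell θ n).app T hn trivial)), ← Category.assoc,
      ← Functor.map_comp, ht, PartialCell.compat, PartialCell.compat]
  · obtain ⟨n, hn⟩ : ∃ n, Level d (n + 1) T := ⟨_, (hd T).choose_spec.succ⟩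
    change t T ≫ _ = _
    rw [← cancel_epi ((solutionCell θ (n + 1)).app T hn trivial), ← Category.assoc, ht,
      solutionCell_succ, ← Category.assoc, solutionCell_succ]
    exact (PartialCell.step_comp c _ _ _ T _ _ _ fun e => ht _ _ _).symm

theorem solution_cell_unique {F G : PartialHom X C fun _ => True}
    (θ : PartialCell F (F.step (d := d) c)) (θ' : PartialCell G (G.step (d := d) c))
    (τ τ' : PartialCell F G)
    (hτ : ∀ T, τ.app T trivial trivial ≫ θ'.app T trivial (fun _ => trivial) =
      θ.app T trivial (fun _ => trivial) ≫ (τ.step c).app T (fun _ => trivial) fun _ => trivial)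
    (hτ' : ∀ T, τ'.app T trivial trivial ≫ θ'.app T trivial (fun _ => trivial) =
      θ.app T trivial (fun _ => trivial) ≫ (τ'.step c).app T (fun _ => trivial) fun _ => trivial) :
    τ = τ' := by
  ext T h h'
  obtain ⟨n, hn⟩ := hd T
  rw [← cancel_epi ((solutionCell θ n).app T hn trivial), solutionCell_comp θ θ' τ hτ,
    solutionCell_comp θ θ' τ' hτ']

omit hd
end

/-! ### Homotopy initiality -/

section
variable {I : Type u} [Groupoid.{v} I]

/-- Every 2-cell of the slice is invertible. -/
def SliceHom.isoOfTwoCell {X : Slice.{u, v, w, w'} I} {Y : Slice.{u, v, x, x'} I}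
    {F G : SliceHom X Y} (σ : F ⟶ G) : F ≅ G where
  hom := σ
  inv :=
    { trans :=
        { app := fun a => Groupoid.inv ((SliceHom.nat σ).app a)
          naturality := fun a a' k => by
            rw [Groupoid.inv_eq_inv, Groupoid.inv_eq_inv, IsIso.comp_inv_eq, Category.assoc,
              NatTrans.naturality, IsIso.inv_hom_id_assoc] }
      compat := fun a => by
        rw [← SliceTwoCell.compat σ a, ← Category.assoc, ← Functor.map_comp, Groupoid.inv_comp,
          CategoryTheory.Functor.map_id, Category.id_comp] }
  hom_inv_id := SliceHom.hom_ext fun a => Groupoid.comp_inv ((SliceHom.nat σ).app a)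
  inv_hom_id := SliceHom.hom_ext fun a => Groupoid.inv_comp ((SliceHom.nat σ).app a)

section
variable {X : Slice.{u, v, w, w'} I} {Y : Slice.{u, v, x, x'} I} (F : SliceHom X Y)
  [F.functor.IsEquivalence]

/-- The counit of the equivalence underlying a 1-cell. -/
abbrev SliceHom.counitApp (y : Y.carrier) : F.functor.obj (F.functor.inv.obj y) ⟶ y :=
  F.functor.asEquivalence.counit.app y

/-- The unit of the equivalence underlying a 1-cell. -/
abbrev SliceHom.unitApp (a : X.carrier) : a ⟶ F.functor.inv.obj (F.functor.obj a) :=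
  F.functor.asEquivalence.unit.app a

theorem SliceHom.counitApp_naturality {y y' : Y.carrier} (k : y ⟶ y') :
    F.functor.map (F.functor.inv.map k) ≫ F.counitApp y' = F.counitApp y ≫ k :=
  F.functor.asEquivalence.counit.naturality k

theorem SliceHom.map_unitApp_comp (a : X.carrier) :
    F.functor.map (F.unitApp a) ≫ F.counitApp (F.functor.obj a) = 𝟙 _ :=
  F.functor.asEquivalence.functor_unit_comp a

/-- The inverse of a 1-cell of the slice whose underlying functor is an equivalence. -/
def SliceHom.inverse : SliceHom Y X where
  functor := F.functor.inv
  triangle y := Groupoid.inv (F.triangle (F.functor.inv.obj y)) ≫ Y.proj.map (F.counitApp y)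
  natural {y y'} k := by
    rw [Category.assoc, ← Functor.map_comp, ← F.counitApp_naturality k, Functor.map_comp,
      ← Category.assoc, ← Category.assoc]
    congr 1
    rw [Groupoid.inv_eq_inv, Groupoid.inv_eq_inv, IsIso.comp_inv_eq, Category.assoc, F.natural,
      IsIso.inv_hom_id_assoc]

/-- The unit of the equivalence is a 2-cell over `I`. This is the triangle identity of the adjoint
equivalence, projected to `I` by naturality of the triangle of `F`. -/
theorem SliceHom.inverse_triangle_comp (a : X.carrier) :
    X.proj.map (F.unitApp a) ≫ F.inverse.triangle (F.functor.obj a) ≫ F.triangle a = 𝟙 _ := by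
  change X.proj.map (F.unitApp a) ≫
    (Groupoid.inv (F.triangle (F.functor.inv.obj (F.functor.obj a))) ≫ _) ≫ _ = _
  rw [Groupoid.inv_eq_inv, Category.assoc, ← cancel_epi (F.triangle a), ← Category.assoc,
    ← F.natural, Category.assoc, IsIso.hom_inv_id_assoc, ← Category.assoc, ← Functor.map_comp,
    F.map_unitApp_comp, CategoryTheory.Functor.map_id, Category.id_comp, Category.comp_id]

end

variable {P : PolyEndo.{u, v} I} {D : Slice.{u, v, w, w'} I} (d : SliceHom D (P.obj D))

namespace AlgHom

section
variable {d} {C : Alg.{u, v, x, x'} P}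
  (F : PartialHom D C.X fun _ => True) (θ : PartialCell F (F.step (d := d) C.str))

/-- The component of a solution of the recursion equation. -/
abbrev solutionApp (T : D.carrier) : F.obj T trivial ⟶
    glueObj C.str (F.mapObj (parts d T) fun _ => trivial) :=
  θ.app T trivial fun _ => trivial

theorem solutionApp_naturality {T T' : D.carrier} (g : T ⟶ T') :
    F.map trivial trivial g ≫ solutionApp F θ T' = solutionApp F θ T ≫
      glueMap C.str (F.mapHom (fun _ => trivial) (fun _ => trivial) (partsMap d g)) :=
  θ.naturality g _ _ _ _

theorem solutionApp_compat (T : D.carrier) : C.X.proj.map (solutionApp F θ T) ≫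
    glueTriangle C.str (F.mapObj (parts d T) fun _ => trivial) ≫ partsTriangle d T =
      F.triangle T trivial :=
  θ.compat T _ _

end

end AlgHom

/-! ### Homomorphisms out of the inverse of a coalgebra -/

variable [d.functor.IsEquivalence]

/-- The counit of the equivalence underlying a coalgebra, as an arrow of `P(D)`. -/
abbrev partsCounit (S : P.EvalObj D) : EvalHom (parts d (glueObj d.inverse S)) S :=
  d.functor.asEquivalence.counit.app S

/-- The unit of the equivalence underlying a coalgebra. -/
abbrev partsUnit (T : D.carrier) : T ⟶ glueObj d.inverse (parts d T) :=
  d.functor.asEquivalence.unit.app T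

theorem partsCounit_naturality {S S' : P.EvalObj D} (g : EvalHom S S') :
    (partsMap d (glueMap d.inverse g)).comp (partsCounit d S') = (partsCounit d S).comp g :=
  d.functor.asEquivalence.counit.naturality (X := S) (Y := S') g

theorem partsUnit_naturality {T T' : D.carrier} (g : T ⟶ T') :
    g ≫ partsUnit d T' = partsUnit d T ≫ glueMap d.inverse (partsMap d g) :=
  d.functor.asEquivalence.unit.naturality g

theorem partsUnit_counit (S : P.EvalObj D) :
    partsUnit d (glueObj d.inverse S) ≫ glueMap d.inverse (partsCounit d S) = 𝟙 _ :=
  d.functor.asEquivalence.unit_inverse_comp S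

theorem partsUnit_triangle (T : D.carrier) :
    D.proj.map (partsUnit d T) ≫ glueTriangle d.inverse (parts d T) ≫ partsTriangle d T = 𝟙 _ :=
  d.inverse_triangle_comp T

variable {C : Alg.{u, v, x, x'} P}

variable {d}

namespace AlgHom

/-- The component of the 2-cell of an algebra homomorphism. -/
abbrev squareApp (F : AlgHom (⟨D, d.inverse⟩ : Alg P) C) (S : P.EvalObj D) :
    F.hom.functor.obj (glueObj d.inverse S) ⟶
      glueObj C.str (F.hom.toPartial.mapObj S fun _ => trivial) :=
  (SliceHom.nat F.square.hom).app S

theorem squareApp_naturality (F : AlgHom (⟨D, d.inverse⟩ : Alg P) C) {S S' : P.EvalObj D}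
    (g : EvalHom S S') : F.hom.functor.map (glueMap d.inverse g) ≫ F.squareApp S' =
      F.squareApp S ≫ glueMap C.str (F.hom.toPartial.mapHom (fun _ => trivial)
        (fun _ => trivial) g) :=
  (SliceHom.nat F.square.hom).naturality (X := S) (Y := S') g

theorem squareApp_compat (F : AlgHom (⟨D, d.inverse⟩ : Alg P) C) (S : P.EvalObj D) :
    C.X.proj.map (F.squareApp S) ≫
      glueTriangle C.str (F.hom.toPartial.mapObj S fun _ => trivial) =
    F.hom.triangle (glueObj d.inverse S) ≫ glueTriangle d.inverse S := by
  refine Eq.trans ?_ (SliceTwoCell.compat F.square.hom S)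
  exact congrArg (_ ≫ ·) (Category.comp_id _).symm

/-- The recursion equation satisfied by an algebra homomorphism. -/
def recursion (F : AlgHom (⟨D, d.inverse⟩ : Alg P) C) :
    PartialCell F.hom.toPartial (F.hom.toPartial.step (d := d) C.str) where
  app T _ _ := F.hom.functor.map (partsUnit d T) ≫ F.squareApp (parts d T)
  naturality {T T'} g _ _ _ _ := by
    change F.hom.functor.map g ≫ _ ≫ _ = (_ ≫ _) ≫ glueMap C.str _
    rw [← Category.assoc, ← Functor.map_comp]
    refine (congrArg (fun z => F.hom.functor.map z ≫ _) (partsUnit_naturality d g)).trans ?_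
    rw [Functor.map_comp, Category.assoc, squareApp_naturality, Category.assoc]
  compat T _ _ := by
    change C.X.proj.map (F.hom.functor.map (partsUnit d T) ≫ F.squareApp (parts d T)) ≫
      glueTriangle C.str (F.hom.toPartial.mapObj (parts d T) fun _ => trivial) ≫
        partsTriangle d T = F.hom.triangle T
    rw [Functor.map_comp, Category.assoc, ← Category.assoc (C.X.proj.map (F.squareApp _)),
      squareApp_compat, ← Category.assoc, ← Category.assoc, F.hom.natural, Category.assoc,
      Category.assoc]
    exact (congrArg (F.hom.triangle T ≫ ·) (partsUnit_triangle d T)).trans (Category.comp_id _)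

/-- The square of a homomorphism is indexed by the objects of `P(D)`, the recursion equation by
those of `D`. The unit of the equivalence passes from the first to the second, the counit back. -/
theorem twoCell_compat_iff (F G : AlgHom (⟨D, d.inverse⟩ : Alg P) C) (τ : F.hom ⟶ G.hom) :
    (Alg.str (⟨D, d.inverse⟩ : Alg P)).whiskerLeft τ ≫ G.square.hom =
        F.square.hom ≫ SliceHom.whiskerRight (P.map₂ τ) C.str ↔
      ∀ T, (SliceHom.toPartialCell τ).app T trivial trivial ≫
          G.recursion.app T trivial (fun _ => trivial) =
        F.recursion.app T trivial (fun _ => trivial) ≫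
          ((SliceHom.toPartialCell τ).step (d := d) C.str).app T (fun _ => trivial)
            fun _ => trivial := by
  have key : (Alg.str (⟨D, d.inverse⟩ : Alg P)).whiskerLeft τ ≫ G.square.hom =
        F.square.hom ≫ SliceHom.whiskerRight (P.map₂ τ) C.str ↔
      ∀ S : P.EvalObj D, (SliceHom.nat τ).app (glueObj d.inverse S) ≫ G.squareApp S =
        F.squareApp S ≫ glueMap C.str ((SliceHom.toPartialCell τ).map S (fun _ => trivial)
          fun _ => trivial) :=
    ⟨fun h S => congrArg (fun z => (SliceHom.nat z).app S) h, fun h => SliceHom.hom_ext h⟩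
  rw [key]
  constructor
  · intro h T
    change (SliceHom.nat τ).app T ≫ G.hom.functor.map (partsUnit d T) ≫ G.squareApp (parts d T) =
      (F.hom.functor.map (partsUnit d T) ≫ F.squareApp (parts d T)) ≫ glueMap C.str _
    rw [← Category.assoc, ← NatTrans.naturality, Category.assoc, h, Category.assoc]
  · intro h S
    have h1 : (SliceHom.nat τ).app (glueObj d.inverse S) ≫
        G.hom.functor.map (partsUnit d (glueObj d.inverse S)) ≫
          G.squareApp (parts d (glueObj d.inverse S)) =
      (F.hom.functor.map (partsUnit d (glueObj d.inverse S)) ≫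
        F.squareApp (parts d (glueObj d.inverse S))) ≫
          glueMap C.str ((SliceHom.toPartialCell τ).map (parts d (glueObj d.inverse S))
            (fun _ => trivial) fun _ => trivial) := h (glueObj d.inverse S)
    -- The equation at `d⁻¹ S` is composed with the image of the counit at `S`. Naturality moves the
    -- counit to the left until it meets the unit, and the two cancel by the triangle identity.
    have h2 := congrArg (· ≫ glueMap C.str (G.hom.toPartial.mapHom (fun _ => trivial)
      (fun _ => trivial) (partsCounit d S))) h1
    simp only [Category.assoc] at h2
    rw [← squareApp_naturality, ← glueMap_comp, ← PartialCell.map_naturality, glueMap_comp,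
      ← Category.assoc (F.squareApp _), ← squareApp_naturality, ← Category.assoc (G.hom.functor.map _),
      ← Functor.map_comp, Category.assoc, ← Category.assoc (F.hom.functor.map _),
      ← Functor.map_comp, partsUnit_counit, CategoryTheory.Functor.map_id,
      CategoryTheory.Functor.map_id, Category.id_comp, Category.id_comp] at h2
    exact h2

section
variable (F : PartialHom D C.X fun _ => True) (θ : PartialCell F (F.step (d := d) C.str))

/-- The component of the 2-cell of the algebra homomorphism given by a solution of the recursion
equation. -/
def ofRecursionApp (S : P.EvalObj D) : F.obj (glueObj d.inverse S) trivial ⟶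
    glueObj C.str (F.mapObj S fun _ => trivial) :=
  solutionApp F θ (glueObj d.inverse S) ≫
    glueMap C.str (F.mapHom (fun _ => trivial) (fun _ => trivial) (partsCounit d S))

theorem ofRecursionApp_naturality {S S' : P.EvalObj D} (g : EvalHom S S') :
    F.map trivial trivial (glueMap d.inverse g) ≫ ofRecursionApp F θ S' =
      ofRecursionApp F θ S ≫ glueMap C.str (F.mapHom (fun _ => trivial) (fun _ => trivial) g) := by
  rw [ofRecursionApp, ofRecursionApp, ← Category.assoc, solutionApp_naturality,
    Category.assoc, Category.assoc, ← glueMap_comp, ← PartialHom.mapHom_comp,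
    partsCounit_naturality, ← glueMap_comp, ← PartialHom.mapHom_comp]

theorem ofRecursionApp_compat (S : P.EvalObj D) : C.X.proj.map (ofRecursionApp F θ S) ≫
    glueTriangle C.str (F.mapObj S fun _ => trivial) =
      F.triangle (glueObj d.inverse S) trivial ≫ glueTriangle d.inverse S := by
  -- The triangle of `d.inverse` starts with the inverse of the triangle of `d`, so only the image
  -- of the counit remains.
  have h2 : partsTriangle d (glueObj d.inverse S) ≫ glueTriangle d.inverse S =
      P.t.map (partsCounit d S).base :=
    (Category.assoc _ _ _).symm.trans
      ((congrArg (· ≫ _) (Groupoid.comp_inv _)).trans (Category.id_comp _))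
  rw [← solutionApp_compat F θ, ofRecursionApp, Functor.map_comp, Category.assoc,
    glueTriangle_natural, Category.assoc, Category.assoc, h2]

/-- The algebra homomorphism given by a solution of the recursion equation. -/
def ofRecursion : AlgHom (⟨D, d.inverse⟩ : Alg P) C where
  hom := F.toHom
  square := SliceHom.isoOfTwoCell
    { trans :=
        { app := fun S => ofRecursionApp F θ S
          naturality := fun _ _ g => ofRecursionApp_naturality F θ g }
      compat := fun S => (congrArg (_ ≫ ·) (Category.comp_id _)).trans
        (ofRecursionApp_compat F θ S) }

end

end AlgHom

/-- The algebra inverse to a well-founded coalgebra is homotopy initial. -/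
theorem isHomotopyInitial_inverse (hd : ∀ T, ∃ n, Level d n T) :
    (⟨D, d.inverse⟩ : Alg P).IsHomotopyInitial := by
  intro C
  rw [equiv_punit_iff_unique]
  -- Contractible means inhabited with exactly one arrow between any two objects. Both homomorphisms
  -- are now viewed as solutions of the recursion equation.
  refine ⟨⟨AlgHom.ofRecursion _ (limitFix C.str hd)⟩, fun F G => ?_⟩
  obtain ⟨τ, hτ⟩ := exists_solution_cell hd F.recursion G.recursion
  let τ' : F.hom ⟶ G.hom :=
    { trans :=
        { app := fun T => τ.app T trivial trivial
          naturality := fun _ _ g => τ.naturality g trivial trivial trivial trivial }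
      compat := fun T => τ.compat T trivial trivial }
  refine ⟨⟨⟨⟨τ', (F.twoCell_compat_iff G τ').mpr hτ⟩⟩, fun σ => ?_⟩⟩
  refine AlgTwoCell.ext (SliceHom.hom_ext fun T => ?_)
  have := solution_cell_unique hd F.recursion G.recursion
    (SliceHom.toPartialCell (AlgTwoCell.cell σ)) τ
    ((F.twoCell_compat_iff G _).mp (AlgTwoCell.compat σ)) hτ
  exact congrArg (fun z => z.app T trivial trivial) this

end

/-! ### Elements of families -/

/-- The elements over `x` of the representable family `f`. -/
abbrev El {ι : Type w} {C : Type u} [Category.{v} C] (f : ι → C) (x : C) := Σ i, (x ⟶ f i)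

namespace El

section
variable {ι : Type w} {C : Type u} [Category.{v} C] {f : ι → C} {x y z : C}

theorem mk_eq_iff {i j : ι} {h : x ⟶ f i} {h' : x ⟶ f j} :
    (⟨i, h⟩ : El f x) = ⟨j, h'⟩ ↔ ∃ e : i = j, h ≫ eqToHom (congrArg f e) = h' := by
  constructor
  · intro e
    cases e
    exact ⟨rfl, by simp⟩
  · rintro ⟨rfl, e⟩
    simp at e
    rw [e]

/-- Restriction of an element along an arrow. -/
def pre (g : y ⟶ x) (a : El f x) : El f y := ⟨a.1, g ≫ a.2⟩

theorem pre_mk (g : y ⟶ x) (i : ι) (h : x ⟶ f i) : pre g (⟨i, h⟩ : El f x) = ⟨i, g ≫ h⟩ := rfl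

@[simp]
theorem pre_id (a : El f x) : pre (𝟙 x) a = a := by
  obtain ⟨i, h⟩ := a
  simp [pre]

@[simp]
theorem pre_pre (g : y ⟶ x) (k : z ⟶ y) (a : El f x) : pre k (pre g a) = pre (k ≫ g) a := by
  simp [pre]

theorem eq_pre (a : El f x) : a = pre a.2 ⟨a.1, 𝟙 _⟩ := by simp [pre]

theorem pre_injective {C : Type u} [Groupoid.{v} C] {f : ι → C} {x y : C} (g : y ⟶ x) :
    Function.Injective (pre g : El f x → El f y) := fun a b h => by
  simpa using congrArg (pre (Groupoid.inv g)) h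

/-- The map of elements given by a map of families. -/
def map {κ : Type w'} {g : κ → C} (α : ∀ i, El g (f i)) (a : El f x) : El g x :=
  pre a.2 (α a.1)

theorem map_pre {κ : Type w'} {g : κ → C} (α : ∀ i, El g (f i)) (k : y ⟶ x) (a : El f x) :
    map α (pre k a) = pre k (map α a) := by
  simp [map, pre]

/-- The map of elements over `K x` given by a map of families over a functor `K`. -/
def mapAlong {D : Type u} [Category.{v} D] (K : C ⥤ D) {κ : Type w'} {g : κ → D} (r : ι → κ)
    (i : ∀ m, K.obj (f m) ⟶ g (r m)) (a : El f x) : El g (K.obj x) :=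
  ⟨r a.1, K.map a.2 ≫ i a.1⟩

theorem mapAlong_pre {D : Type u} [Category.{v} D] (K : C ⥤ D) {κ : Type w'} {g : κ → D}
    (r : ι → κ) (i : ∀ m, K.obj (f m) ⟶ g (r m)) (k : y ⟶ x) (a : El f x) :
    mapAlong K r i (pre k a) = pre (K.map k) (mapAlong K r i a) := by
  simp [mapAlong, pre]

/-- By the Yoneda argument: every element is the restriction of a universal one `⟨m, 𝟙⟩`, and all
the maps commute with restriction. -/
theorem map_mapAlong {D : Type u} [Category.{v} D] (K : C ⥤ D) {κ : Type w'} {g : κ → D}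
    {r : ι → κ} {i : ∀ m, K.obj (f m) ⟶ g (r m)} {ι' : Type w} {κ' : Type w'} {f' : ι' → C}
    {g' : κ' → D} {r' : ι' → κ'} {i' : ∀ m, K.obj (f' m) ⟶ g' (r' m)}
    {α : ∀ a, El g' (g a)} {μ : ∀ m, El f' (f m)}
    (h : ∀ m, pre (i m) (α (r m)) = mapAlong K r' i' (μ m)) (a : El f x) :
    map α (mapAlong K r i a) = mapAlong K r' i' (map μ a) := by
  rw [map, map, mapAlong_pre, ← h, pre_pre]
  rfl

end
end El

/-- A square of groupoids with discrete corners is a homotopy pullback if and only if the induced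
maps of elements are bijective. -/
theorem isEquivalence_discrete_comma_iff {E : Type u} {B : Type u} [Groupoid.{v} E]
    [Groupoid.{v} B] (K : E ⥤ B) {M N : Type w} (mark : M → E) (node : N → B) (r : M → N)
    (i : ∀ m, K.obj (mark m) ⟶ node (r m)) :
    (Discrete.functor fun m : M =>
      (⟨mark m, ⟨r m⟩, i m⟩ : Comma K (Discrete.functor node))).IsEquivalence ↔
    ∀ x, Function.Bijective (El.mapAlong (x := x) K r i) := by
  constructor
  · intro h x
    constructor
    · rintro ⟨m, k⟩ ⟨m', k'⟩ e
      obtain ⟨e₁, e₂⟩ := El.mk_eq_iff.mp e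
      -- Two elements with the same image differ by an arrow of the comma category. By fullness it
      -- comes from the discrete category, hence it is an identity.
      let l : (⟨mark m, ⟨r m⟩, i m⟩ : Comma K (Discrete.functor node)) ⟶
          ⟨mark m', ⟨r m'⟩, i m'⟩ :=
        { left := Groupoid.inv k ≫ k'
          right := Discrete.eqToHom e₁
          w := by
            rw [Functor.map_comp, Category.assoc]
            refine (congrArg (_ ≫ ·) e₂.symm).trans ?_
            rw [Groupoid.inv_eq_inv, Functor.map_inv, Category.assoc, IsIso.inv_hom_id_assoc]
            congr 1 }
      obtain ⟨q, hq⟩ := h.full.map_surjective (X := ⟨m⟩) (Y := ⟨m'⟩) l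
      obtain rfl : m = m' := Discrete.eq_of_hom q
      obtain rfl : q = 𝟙 _ := Subsingleton.elim _ _
      rw [CategoryTheory.Functor.map_id] at hq
      have hl : 𝟙 (mark m) = Groupoid.inv k ≫ k' := congrArg CommaMorphism.left hq
      rw [Groupoid.inv_eq_inv, IsIso.eq_inv_comp, Category.comp_id] at hl
      rw [hl]
    · rintro ⟨n, φ⟩
      obtain ⟨⟨m⟩, ⟨l⟩⟩ := h.essSurj.mem_essImage
        (⟨x, ⟨n⟩, φ⟩ : Comma K (Discrete.functor node))
      have e : r m = n := Discrete.eq_of_hom l.hom.right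
      refine ⟨⟨m, l.inv.left⟩, ?_⟩
      subst e
      have hw := l.inv.w
      have hr : l.inv.right = 𝟙 _ := Subsingleton.elim _ _
      rw [hr, CategoryTheory.Functor.map_id] at hw
      refine El.mk_eq_iff.mpr ⟨rfl, ?_⟩
      refine (Category.comp_id _).trans (hw.trans (Category.comp_id _))
  · intro h
    refine @CategoryTheory.Functor.IsEquivalence.mk _ _ _ _ _ ⟨?_⟩ ⟨?_⟩ ⟨?_⟩
    · rintro ⟨m⟩ ⟨m'⟩ q q' _
      exact Subsingleton.elim _ _
    · rintro ⟨m⟩ ⟨m'⟩ l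
      have e₁ : r m = r m' := Discrete.eq_of_hom l.right
      have hw : K.map l.left ≫ i m' = i m ≫ eqToHom (congrArg node e₁) := by
        refine l.w.trans (congrArg (i m ≫ ·) ?_)
        obtain ⟨left, right, w⟩ := l
        have hr : right = Discrete.eqToHom e₁ := Subsingleton.elim _ _
        subst hr
        exact eqToHom_map (Discrete.functor node) (congrArg Discrete.mk e₁)
      -- An arrow `l` of the comma category says that `⟨m, 𝟙⟩` and `⟨m', l.left⟩` have the same
      -- image.
      have e := (h (mark m)).1 (a₁ := ⟨m, 𝟙 _⟩) (a₂ := ⟨m', l.left⟩)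
        (El.mk_eq_iff.mpr ⟨e₁, by simp [hw]⟩)
      obtain ⟨rfl, hl⟩ := El.mk_eq_iff.mp e
      refine ⟨𝟙 _, ?_⟩
      rw [CategoryTheory.Functor.map_id]
      refine CommaMorphism.ext ?_ (Subsingleton.elim _ _)
      simpa using hl
    · rintro ⟨x, ⟨n⟩, φ⟩
      obtain ⟨⟨m, k⟩, e⟩ := (h x).2 ⟨n, φ⟩
      obtain ⟨rfl, e₂⟩ := El.mk_eq_iff.mp e
      refine ⟨⟨m⟩, ⟨Comma.isoMk (asIso (Groupoid.inv k)) (Iso.refl _) ?_⟩⟩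
      simp only [eqToHom_refl, Category.comp_id] at e₂
      subst e₂
      simp [Groupoid.inv_eq_inv]

/-! ### Decorated trees in terms of elements -/

section
variable {I : Type u} [Groupoid.{v} I] {P : PolyEndo.{u, v} I}

namespace PTree

variable (T : PTree P)

/-- The map `s` of a `P`-tree on elements. -/
def elS {x : P.E} : El T.mark x → El T.edge (P.s.obj x) := El.mapAlong P.s T.tree.s T.isoS

/-- The map `p` of a `P`-tree on elements. -/
def elP {x : P.E} : El T.mark x → El T.node (P.p.obj x) := El.mapAlong P.p T.tree.p T.isoP

/-- The map `t` of a `P`-tree on elements. -/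
def elT {b : P.B} : El T.node b → El T.edge (P.t.obj b) := El.mapAlong P.t T.tree.t T.isoT

/-- The homotopy pullback condition is used only in this form: a mark with an arrow from `x` amounts
to a node with an arrow from `p x`. -/
theorem elP_bijective (x : P.E) : Function.Bijective (T.elP (x := x)) :=
  (isEquivalence_discrete_comma_iff _ _ _ _ _).mp T.pullback x

theorem elS_pre {x y : P.E} (k : y ⟶ x) (a : El T.mark x) :
    T.elS (El.pre k a) = El.pre (P.s.map k) (T.elS a) := El.mapAlong_pre _ _ _ _ _

theorem elP_pre {x y : P.E} (k : y ⟶ x) (a : El T.mark x) :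
    T.elP (El.pre k a) = El.pre (P.p.map k) (T.elP a) := El.mapAlong_pre _ _ _ _ _

theorem elT_pre {x y : P.B} (k : y ⟶ x) (a : El T.node x) :
    T.elT (El.pre k a) = El.pre (P.t.map k) (T.elT a) := El.mapAlong_pre _ _ _ _ _

end PTree

namespace PTreeHom

variable {S T U : PTree P}

/-- The action of an isomorphism of `P`-trees on elements of the family of edges. -/
def elA (g : PTreeHom S T) {x : I} : El S.edge x → El T.edge x :=
  El.map fun a => ⟨g.fA a, g.cellA a⟩

/-- The action of an isomorphism of `P`-trees on elements of the family of marks. -/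
def elM (g : PTreeHom S T) {x : P.E} : El S.mark x → El T.mark x :=
  El.map fun a => ⟨g.fM a, g.cellM a⟩

/-- The action of an isomorphism of `P`-trees on elements of the family of nodes. -/
def elN (g : PTreeHom S T) {x : P.B} : El S.node x → El T.node x :=
  El.map fun a => ⟨g.fN a, g.cellN a⟩

theorem elA_pre (g : PTreeHom S T) {x y : I} (k : y ⟶ x) (a : El S.edge x) :
    g.elA (El.pre k a) = El.pre k (g.elA a) := El.map_pre _ _ _

theorem elN_pre (g : PTreeHom S T) {x y : P.B} (k : y ⟶ x) (a : El S.node x) :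
    g.elN (El.pre k a) = El.pre k (g.elN a) := El.map_pre _ _ _

theorem elA_elS (g : PTreeHom S T) {x : P.E} (a : El S.mark x) :
    g.elA (S.elS a) = T.elS (g.elM a) := by
  exact El.map_mapAlong P.s (fun m => El.mk_eq_iff.mpr ⟨g.comm_s m,
    (Category.assoc _ _ _).trans (g.compat_s m)⟩) a

theorem elN_elP (g : PTreeHom S T) {x : P.E} (a : El S.mark x) :
    g.elN (S.elP a) = T.elP (g.elM a) := by
  exact El.map_mapAlong P.p (fun m => El.mk_eq_iff.mpr ⟨g.comm_p m,
    (Category.assoc _ _ _).trans (g.compat_p m)⟩) a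

theorem elA_elT (g : PTreeHom S T) {x : P.B} (a : El S.node x) :
    g.elA (S.elT a) = T.elT (g.elN a) := by
  exact El.map_mapAlong P.t (fun m => El.mk_eq_iff.mpr ⟨g.comm_t m,
    (Category.assoc _ _ _).trans (g.compat_t m)⟩) a

theorem elA_mk (g : PTreeHom S T) (a : S.tree.A) :
    g.elA ⟨a, 𝟙 _⟩ = ⟨g.fA a, g.cellA a⟩ := El.pre_id _

theorem elM_mk (g : PTreeHom S T) (a : S.tree.M) :
    g.elM ⟨a, 𝟙 _⟩ = ⟨g.fM a, g.cellM a⟩ := El.pre_id _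

theorem elN_mk (g : PTreeHom S T) (a : S.tree.N) :
    g.elN ⟨a, 𝟙 _⟩ = ⟨g.fN a, g.cellN a⟩ := El.pre_id _

theorem elN_comp (g : PTreeHom S T) (h : PTreeHom T U) {x : P.B} (a : El S.node x) :
    (g.comp h).elN a = h.elN (g.elN a) := by
  exact congrArg (Sigma.mk _) (Category.assoc _ _ _).symm

theorem ext_el {g h : PTreeHom S T} (hA : ∀ a, g.elA ⟨a, 𝟙 (S.edge a)⟩ = h.elA ⟨a, 𝟙 _⟩)
    (hM : ∀ a, g.elM ⟨a, 𝟙 (S.mark a)⟩ = h.elM ⟨a, 𝟙 _⟩)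
    (hN : ∀ a, g.elN ⟨a, 𝟙 (S.node a)⟩ = h.elN ⟨a, 𝟙 _⟩) : g = h := by
  simp only [elA_mk, elM_mk, elN_mk] at hA hM hN
  exact ext' (Equiv.ext fun a => congrArg Sigma.fst (hA a))
    (Equiv.ext fun a => congrArg Sigma.fst (hM a)) (Equiv.ext fun a => congrArg Sigma.fst (hN a))
    (fun a => (El.mk_eq_iff.mp (hA a)).2) (fun a => (El.mk_eq_iff.mp (hM a)).2)
    (fun a => (El.mk_eq_iff.mp (hN a)).2)

/-- An isomorphism of `P`-trees from its action on elements. -/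
def ofEl (α : ∀ a, El T.edge (S.edge a)) (μ : ∀ a, El T.mark (S.mark a))
    (ν : ∀ a, El T.node (S.node a)) (hα : Function.Bijective fun a => (α a).1)
    (hμ : Function.Bijective fun a => (μ a).1) (hν : Function.Bijective fun a => (ν a).1)
    (hs : ∀ m, El.pre (S.isoS m) (α (S.tree.s m)) = T.elS (μ m))
    (hp : ∀ m, El.pre (S.isoP m) (ν (S.tree.p m)) = T.elP (μ m))
    (ht : ∀ n, El.pre (S.isoT n) (α (S.tree.t n)) = T.elT (ν n)) : PTreeHom S T where
  fA := Equiv.ofBijective _ hα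
  fM := Equiv.ofBijective _ hμ
  fN := Equiv.ofBijective _ hν
  comm_s m := congrArg Sigma.fst (hs m)
  comm_p m := congrArg Sigma.fst (hp m)
  comm_t m := congrArg Sigma.fst (ht m)
  cellA a := (α a).2
  cellM a := (μ a).2
  cellN a := (ν a).2
  compat_s m := (Category.assoc _ _ _).symm.trans (El.mk_eq_iff.mp (hs m)).2
  compat_p m := (Category.assoc _ _ _).symm.trans (El.mk_eq_iff.mp (hp m)).2
  compat_t m := (Category.assoc _ _ _).symm.trans (El.mk_eq_iff.mp (ht m)).2

end PTreeHom

end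

/-! ### Descendants and subtrees -/

theorem walk_apply_s {A M N : Type} {s : M → A} (hs : Function.Injective s) (p : M → N)
    (t : N → A) (m : M) : walk s p t (s m) = t (p m) := by
  have h : ∃ m', s m' = s m := ⟨m, rfl⟩
  rw [walk, dif_pos h, hs h.choose_spec]

/-- The relation between an input edge of a node and the output edge of the node. -/
def Parent {A M N : Type} (s : M → A) (p : M → N) (t : N → A) (a b : A) : Prop :=
  ∃ m, s m = a ∧ t (p m) = b

theorem exists_walk_iterate_eq {A M N : Type} {s : M → A} (hs : Function.Injective s) {p : M → N}
    {t : N → A} {a r : A} (h : Relation.ReflTransGen (Parent s p t) a r) :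
    ∃ k : ℕ, (walk s p t)^[k] a = r := by
  induction h using Relation.ReflTransGen.head_induction_on with
  | refl => exact ⟨0, rfl⟩
  | head h _ ih =>
    obtain ⟨m, rfl, rfl⟩ := h
    obtain ⟨k, hk⟩ := ih
    exact ⟨k + 1, by rw [Function.iterate_succ_apply, walk_apply_s hs, hk]⟩

theorem reflTransGen_walk_iterate {A M N : Type} (s : M → A) (p : M → N) (t : N → A) (k : ℕ)
    (a : A) : Relation.ReflTransGen (Parent s p t) a ((walk s p t)^[k] a) := by
  induction k generalizing a with
  | zero => exact .refl
  | succ k ih =>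
    rw [Function.iterate_succ_apply]
    refine .trans ?_ (ih _)
    by_cases h : ∃ m, s m = a
    · rw [walk, dif_pos h]
      exact .single ⟨_, h.choose_spec, rfl⟩
    · rw [walk, dif_neg h]

namespace Tree

variable (T : Tree)

/-- `T.Desc a c`: the walk from the edge `a` to the root goes through the edge `c`. -/
def Desc : T.A → T.A → Prop := Relation.ReflTransGen (Parent T.s T.p T.t)

variable {T}

theorem Desc.refl (a : T.A) : T.Desc a a := Relation.ReflTransGen.refl

theorem Desc.trans {a b c : T.A} (h : T.Desc a b) (h' : T.Desc b c) : T.Desc a c :=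
  Relation.ReflTransGen.trans h h'

theorem desc_s (m : T.M) : T.Desc (T.s m) (T.t (T.p m)) := .single ⟨m, rfl, rfl⟩

theorem desc_root (a : T.A) : T.Desc a T.root := by
  obtain ⟨k, hk⟩ := T.walk_to_root a
  rw [← hk]
  exact reflTransGen_walk_iterate _ _ _ _ _

theorem root_ne_s (m : T.M) : T.root ≠ T.s m := fun h => by
  have h1 : T.root ∈ (Set.range T.s)ᶜ := by
    rw [T.compl_range_s]
    rfl
  exact h1 ⟨m, h.symm⟩

theorem exists_s_eq {a : T.A} (h : a ≠ T.root) : ∃ m, T.s m = a := by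
  by_contra hn
  have h1 : a ∈ (Set.range T.s)ᶜ := hn
  rw [T.compl_range_s] at h1
  exact h h1

theorem parent_rightUnique : Relator.RightUnique (Parent T.s T.p T.t) := by
  rintro _ _ _ ⟨m, rfl, rfl⟩ ⟨m', h, rfl⟩
  rw [T.s_injective h]

/-- The parent relation has no cycles. Parents being unique, a cycle through an edge also passes
through its parent, and so through the root by induction along the walk; but the root has no parent.
-/
theorem not_desc_of_parent {a b : T.A} (h : Parent T.s T.p T.t a b) : ¬ T.Desc b a := by
  intro h'
  have key : ∀ c, ¬ Relation.TransGen (Parent T.s T.p T.t) c c := by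
    intro c
    induction desc_root c using Relation.ReflTransGen.head_induction_on with
    | refl =>
      intro hc
      obtain ⟨_, ⟨m, hm, -⟩, -⟩ := Relation.TransGen.head'_iff.mp hc
      exact root_ne_s m hm.symm
    | head hab _ ih =>
      intro hc
      obtain ⟨b', hb', hd⟩ := Relation.TransGen.head'_iff.mp hc
      obtain rfl := parent_rightUnique hab hb'
      exact ih (Relation.TransGen.tail' hd hab)
  exact key a (Relation.TransGen.head' h h')

/-- The subtrees over distinct inputs of a node are disjoint. Parents being unique, two edges on the
walk from `a` are comparable; if one input were a proper descendant of the other, the output edge of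
the node would be a descendant of an input edge of the same node. -/
theorem eq_of_desc_s {a : T.A} {m m' : T.M} (hp : T.p m = T.p m') (h : T.Desc a (T.s m))
    (h' : T.Desc a (T.s m')) : m = m' := by
  have aux : ∀ {m m' : T.M}, T.p m = T.p m' → T.Desc (T.s m) (T.s m') → m = m' := by
    intro m m' hp hd
    rcases Relation.ReflTransGen.cases_head hd with h | ⟨c, ⟨m'', hs, rfl⟩, hd'⟩
    · exact T.s_injective h
    · obtain rfl := T.s_injective hs
      exact (not_desc_of_parent ⟨m', rfl, congrArg T.t hp.symm⟩ hd').elim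
  rcases Relation.ReflTransGen.total_of_right_unique parent_rightUnique h h' with hd | hd
  · exact aux hp hd
  · exact (aux hp.symm hd).symm

theorem exists_desc_s {a c : T.A} (h : T.Desc a c) (hne : a ≠ c) :
    ∃ m, T.t (T.p m) = c ∧ T.Desc a (T.s m) := by
  rcases Relation.ReflTransGen.cases_tail h with h | ⟨b, hb, m, rfl, rfl⟩
  · exact (hne h.symm).elim
  · exact ⟨m, rfl, hb⟩

variable (T)

/-- The subtree of descendants of an edge. -/
def sub (c : T.A) : Tree where
  A := {a // T.Desc a c}
  -- The condition is on the output edge of the node and not on `s m`. Otherwise a mark with input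
  -- edge `c` would belong to the subtree, and `c` would not be its root.
  M := {m // T.Desc (T.t (T.p m)) c}
  N := {n // T.Desc (T.t n) c}
  s m := ⟨T.s m.1, (desc_s m.1).trans m.2⟩
  p m := ⟨T.p m.1, m.2⟩
  t n := ⟨T.t n.1, n.2⟩
  root := ⟨c, .refl c⟩
  t_injective _ _ h := Subtype.ext (T.t_injective (congrArg Subtype.val h))
  s_injective _ _ h := Subtype.ext (T.s_injective (congrArg Subtype.val h))
  compl_range_s := by
    ext ⟨a, ha⟩
    constructor
    · intro h
      refine Subtype.ext ?_
      by_contra hne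
      rcases Relation.ReflTransGen.cases_head ha with h' | ⟨b, ⟨m, rfl, rfl⟩, hd⟩
      · exact hne h'
      · exact h ⟨⟨m, hd⟩, rfl⟩
    · rintro h ⟨⟨m, hm⟩, hs⟩
      obtain rfl : a = c := congrArg Subtype.val h
      obtain rfl : T.s m = a := congrArg Subtype.val hs
      exact not_desc_of_parent ⟨m, rfl, rfl⟩ hm
  walk_to_root a := by
    refine exists_walk_iterate_eq
      (fun _ _ h => Subtype.ext (T.s_injective (congrArg Subtype.val h))) ?_
    obtain ⟨a, ha⟩ := a
    induction ha using Relation.ReflTransGen.head_induction_on with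
    | refl => exact .refl
    | head h hd ih =>
      obtain ⟨m, rfl, rfl⟩ := h
      exact .head ⟨⟨m, hd⟩, rfl, rfl⟩ ih

end Tree

section
variable {I : Type u} [Groupoid.{v} I] {P : PolyEndo.{u, v} I}

namespace El

variable {ι : Type w} {C : Type u} [Category.{v} C] {f : ι → C} {x : C} {q : ι → Prop}

/-- The inclusion of the elements of a subfamily. -/
def val (a : El (fun i : Subtype q => f i.1) x) : El f x := ⟨a.1.1, a.2⟩

theorem val_injective : Function.Injective (val (f := f) (x := x) (q := q)) := by
  rintro ⟨⟨a, ha⟩, k⟩ ⟨⟨a', ha'⟩, k'⟩ h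
  obtain ⟨e₁, e⟩ := mk_eq_iff.mp h
  obtain rfl : a = a' := e₁
  obtain rfl : k = k' := (Category.comp_id k).symm.trans e
  rfl

end El

namespace PTree

/-- The `P`-tree of descendants of an edge. -/
def sub (T : PTree P) (c : T.tree.A) : PTree P where
  tree := T.tree.sub c
  edge a := T.edge a.1
  mark m := T.mark m.1
  node n := T.node n.1
  isoS m := T.isoS m.1
  isoP m := T.isoP m.1
  isoT n := T.isoT n.1
  pullback := by
    refine (isEquivalence_discrete_comma_iff P.p (fun m : (T.tree.sub c).M => T.mark m.1)
      (fun n : (T.tree.sub c).N => T.node n.1) (T.tree.sub c).p fun m => T.isoP m.1).mpr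
      fun x => ⟨fun a a' e => ?_, fun b => ?_⟩
    · exact El.val_injective ((T.elP_bijective x).1 (congrArg El.val e))
    · obtain ⟨a, e⟩ := (T.elP_bijective x).2 (El.val b)
      have h : T.tree.p a.1 = b.1.1 := congrArg Sigma.fst e
      exact ⟨⟨⟨a.1, by rw [h]; exact b.1.2⟩, a.2⟩, El.val_injective e⟩

/-- The inclusion of elements of a subtree. -/
def valA (T : PTree P) (c : T.tree.A) {x : I} (a : El (T.sub c).edge x) : El T.edge x :=
  El.val a

/-- The inclusion of elements of a subtree. -/
def valM (T : PTree P) (c : T.tree.A) {x : P.E} (a : El (T.sub c).mark x) : El T.mark x :=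
  El.val a

/-- The inclusion of elements of a subtree. -/
def valN (T : PTree P) (c : T.tree.A) {x : P.B} (a : El (T.sub c).node x) : El T.node x :=
  El.val a

theorem valN_injective (T : PTree P) (c : T.tree.A) {x : P.B} :
    Function.Injective (T.valN c (x := x)) := El.val_injective

end PTree

namespace PTreeHom

variable {S T U : PTree P}

theorem desc_map (g : PTreeHom S T) {a c : S.tree.A} (h : S.tree.Desc a c) :
    T.tree.Desc (g.fA a) (g.fA c) := by
  refine Relation.ReflTransGen.lift g.fA ?_ _ _ h
  rintro _ _ ⟨m, rfl, rfl⟩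
  exact ⟨g.fM m, (g.comm_s m).symm, by rw [g.comm_t, g.comm_p]⟩

theorem desc_map_iff (g : PTreeHom S T) {a c : S.tree.A} :
    T.tree.Desc (g.fA a) (g.fA c) ↔ S.tree.Desc a c := by
  refine ⟨fun h => ?_, g.desc_map⟩
  have := g.inv.desc_map h
  simpa using this

/-- The restriction of an isomorphism to the subtrees of descendants of corresponding edges. -/
def sub (g : PTreeHom S T) {c : S.tree.A} {c' : T.tree.A} (h : g.fA c = c') :
    PTreeHom (S.sub c) (T.sub c') where
  fA := g.fA.subtypeEquiv fun a => by rw [← h, g.desc_map_iff]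
  fM := g.fM.subtypeEquiv fun m => by rw [← h, ← g.comm_p, ← g.comm_t, g.desc_map_iff]
  fN := g.fN.subtypeEquiv fun n => by rw [← h, ← g.comm_t, g.desc_map_iff]
  comm_s m := Subtype.ext (g.comm_s m.1)
  comm_p m := Subtype.ext (g.comm_p m.1)
  comm_t n := Subtype.ext (g.comm_t n.1)
  cellA a := g.cellA a.1
  cellM m := g.cellM m.1
  cellN n := g.cellN n.1
  compat_s m := g.compat_s m.1
  compat_p m := g.compat_p m.1
  compat_t n := g.compat_t n.1

theorem sub_comp (g : PTreeHom S T) (k : PTreeHom T U) {c : S.tree.A} {c' : T.tree.A}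
    {c'' : U.tree.A} (h : g.fA c = c') (h' : k.fA c' = c'') (h'' : (g.comp k).fA c = c'') :
    (g.sub h).comp (k.sub h') = (g.comp k).sub h'' :=
  ext' rfl rfl rfl (fun _ => Category.comp_id _) (fun _ => Category.comp_id _)
    (fun _ => Category.comp_id _)

end PTreeHom

end

/-! ### Decomposition of dead trees -/

section
variable {I : Type u} [Groupoid.{v} I] {P : PolyEndo.{u, v} I}

namespace PTree

/-- The mark over a node `n` given by an arrow to the decoration of `n`. -/
def markOf (T : PTree P) (n : T.tree.N) {x : P.E} (φ : P.p.obj x ⟶ T.node n) : El T.mark x :=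
  ((T.elP_bijective x).2 ⟨n, φ⟩).choose

theorem elP_markOf (T : PTree P) (n : T.tree.N) {x : P.E} (φ : P.p.obj x ⟶ T.node n) :
    T.elP (T.markOf n φ) = ⟨n, φ⟩ :=
  ((T.elP_bijective x).2 ⟨n, φ⟩).choose_spec

theorem eq_markOf (T : PTree P) {n : T.tree.N} {x : P.E} {φ : P.p.obj x ⟶ T.node n}
    {a : El T.mark x} (h : T.elP a = ⟨n, φ⟩) : a = T.markOf n φ :=
  (T.elP_bijective x).1 (h.trans (T.elP_markOf n φ).symm)

theorem pre_markOf (T : PTree P) {n : T.tree.N} {x y : P.E} (k : y ⟶ x)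
    {φ : P.p.obj x ⟶ T.node n} {ψ : P.p.obj y ⟶ T.node n} (h : P.p.map k ≫ φ = ψ) :
    El.pre k (T.markOf n φ) = T.markOf n ψ := by
  refine T.eq_markOf ?_
  rw [elP_pre, elP_markOf, El.pre_mk, h]

theorem _root_.GrpdPoly.PTreeHom.elM_markOf {S T : PTree P} (g : PTreeHom S T) {n : S.tree.N}
    {n' : T.tree.N} {x : P.E} {φ : P.p.obj x ⟶ S.node n} {φ' : P.p.obj x ⟶ T.node n'}
    (h : g.elN ⟨n, φ⟩ = ⟨n', φ'⟩) : g.elM (S.markOf n φ) = T.markOf n' φ' := by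
  refine T.eq_markOf ?_
  rw [← PTreeHom.elN_elP, elP_markOf, h]

end PTree

theorem PTreeHom.cellA_comp_inv {S T : PTree P} (g : PTreeHom S T) {x y : I} {k : y ⟶ x}
    {a : El S.edge y} {a' : El T.edge x} (h : g.elA a = El.pre k a') (h' : g.fA a.1 = a'.1) :
    (g.cellA a.1 ≫ eqToHom (congrArg T.edge h')) ≫ Groupoid.inv a'.2 =
      Groupoid.inv a.2 ≫ k := by
  have h1 : (a.2 ≫ g.cellA a.1) ≫ eqToHom (congrArg T.edge h') = k ≫ a'.2 :=
    (El.mk_eq_iff.mp h).2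
  rw [Groupoid.inv_eq_inv, Groupoid.inv_eq_inv, IsIso.comp_inv_eq, Category.assoc, ← h1,
    Category.assoc, IsIso.inv_hom_id_assoc]

theorem PTreeHom.elA_id (S : PTree P) {x : I} (a : El S.edge x) : (PTreeHom.id S).elA a = a :=
  congrArg (Sigma.mk _) (Category.comp_id _)

theorem PTreeHom.elN_id (S : PTree P) {x : P.B} (a : El S.node x) : (PTreeHom.id S).elN a = a :=
  congrArg (Sigma.mk _) (Category.comp_id _)

/-- A dead `P`-tree. -/
abbrev DeadTree (P : PolyEndo.{u, v} I) := (IsDead P).FullSubcategory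

namespace DeadTree

/-- The form in which deadness is used: every edge has a node above it. -/
theorem exists_t_eq (T : DeadTree P) (a : T.obj.tree.A) : ∃ n, T.obj.tree.t n = a := by
  by_contra h
  have h1 : a ∈ T.obj.tree.leaves := h
  have h2 : T.obj.tree.leaves = ∅ := T.property
  rw [h2] at h1
  exact h1

/-- The dead tree of descendants of an edge. -/
def sub (T : DeadTree P) (c : T.obj.tree.A) : DeadTree P where
  obj := T.obj.sub c
  property := by
    refine Set.eq_empty_of_forall_notMem ?_
    rintro ⟨a, ha⟩ h
    obtain ⟨n, rfl⟩ := T.exists_t_eq a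
    exact h ⟨⟨n, ha⟩, rfl⟩

/-- The isomorphism of `P`-trees underlying an arrow of dead trees. -/
abbrev toHom {S T : DeadTree P} (g : S ⟶ T) : PTreeHom S.obj T.obj := g.hom

/-- The restriction of an isomorphism to the subtrees of descendants of corresponding edges. -/
def subHom {S T : DeadTree P} (g : S ⟶ T) {c : S.obj.tree.A} {c' : T.obj.tree.A}
    (h : (toHom g).fA c = c') : S.sub c ⟶ T.sub c' :=
  ObjectProperty.homMk ((toHom g).sub h)

theorem subHom_comp {S T U : DeadTree P} (g : S ⟶ T) (k : T ⟶ U) {c : S.obj.tree.A}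
    {c' : T.obj.tree.A} {c'' : U.obj.tree.A} (h : (toHom g).fA c = c')
    (h' : (toHom k).fA c' = c'') : subHom g h ≫ subHom k h' =
      subHom (g ≫ k) (show (toHom k).fA ((toHom g).fA c) = c'' by rw [h, h']) :=
  ObjectProperty.hom_ext _ (PTreeHom.sub_comp (toHom g) (toHom k) h h'
    (show (toHom k).fA ((toHom g).fA c) = c'' by rw [h, h']))

theorem subHom_congr {S T : DeadTree P} {g g' : S ⟶ T} (e : g = g') {c : S.obj.tree.A}
    {c' : T.obj.tree.A} (h : (toHom g).fA c = c') (h' : (toHom g').fA c = c') :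
    subHom g h = subHom g' h' := by
  subst e
  rfl

theorem subHom_id (T : DeadTree P) (c : T.obj.tree.A) :
    subHom (𝟙 T) (c := c) (c' := c) rfl = 𝟙 (T.sub c) := rfl

variable (T : DeadTree P)

/-- The node whose output edge is the root. -/
def rootNode : T.obj.tree.N := (T.exists_t_eq T.obj.tree.root).choose

theorem t_rootNode : T.obj.tree.t T.rootNode = T.obj.tree.root :=
  (T.exists_t_eq T.obj.tree.root).choose_spec

variable {T} in
theorem eq_rootNode {n : T.obj.tree.N} (h : T.obj.tree.t n = T.obj.tree.root) : n = T.rootNode :=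
  T.obj.tree.t_injective (h.trans T.t_rootNode.symm)

/-- The operation decorating the root node. -/
abbrev rootOp : P.B := T.obj.node T.rootNode

/-- The mark corresponding to an input of the root node. -/
abbrev rootMark (e : P.Fibre T.rootOp) : El T.obj.mark e.left := T.obj.markOf T.rootNode e.hom

/-- The input edge corresponding to an input of the root node. -/
abbrev input (e : P.Fibre T.rootOp) : El T.obj.edge (P.s.obj e.left) := T.obj.elS (T.rootMark e)

theorem pre_rootMark {e e' : P.Fibre T.rootOp} (k : e ⟶ e') :
    El.pre k.left (T.rootMark e') = T.rootMark e :=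
  T.obj.pre_markOf k.left (CostructuredArrow.w k)

theorem pre_input {e e' : P.Fibre T.rootOp} (k : e ⟶ e') :
    El.pre (P.s.map k.left) (T.input e') = T.input e := by
  rw [input, ← PTree.elS_pre, pre_rootMark]

/-- Restriction of elements keeps the index, so inputs joined by an arrow of the fibre have the same
edge. The decoration of the root can therefore act on arrows by `subHom` of the identity, in place
of a transport. -/
theorem input_fst {e e' : P.Fibre T.rootOp} (k : e ⟶ e') : (T.input e).1 = (T.input e').1 :=
  (congrArg Sigma.fst (T.pre_input k)).symm

variable {T} in
theorem rootColour_subHom {S : DeadTree P} (g : S ⟶ T) {x y : I} {k : y ⟶ x}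
    {a : El S.obj.edge y} {a' : El T.obj.edge x} (h : (toHom g).elA a = El.pre k a')
    (h' : (toHom g).fA a.1 = a'.1) :
    (deadTrees P).proj.map (subHom g h') ≫ Groupoid.inv a'.2 = Groupoid.inv a.2 ≫ k :=
  (toHom g).cellA_comp_inv h h'

/-- The root node of a dead tree with the subtrees above it. -/
def unglueObj : P.EvalObj (deadTrees P) where
  op := T.rootOp
  dec :=
    { obj := fun e => T.sub (T.input e).1
      map := fun k => subHom (𝟙 T) (T.input_fst k)
      map_id := fun _ => T.subHom_id _
      map_comp := fun k k' => (subHom_congr (Category.comp_id (𝟙 T)).symm _ _).trans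
        (subHom_comp (𝟙 T) (𝟙 T) (T.input_fst k) (T.input_fst k')).symm }
  triangle e := Groupoid.inv (T.input e).2
  natural k := rootColour_subHom (𝟙 T) ((PTreeHom.elA_id _ _).trans (T.pre_input k).symm)
    (T.input_fst k)

/-! ### Functoriality and faithfulness of the decomposition -/

variable {T} {S : DeadTree P}

theorem fN_rootNode (g : S ⟶ T) : (toHom g).fN S.rootNode = T.rootNode :=
  T.eq_rootNode (by rw [← (toHom g).comm_t, t_rootNode, PTreeHom.map_root])

/-- The action of an isomorphism on the decorations of the root nodes. -/
def rootOpMap (g : S ⟶ T) : S.rootOp ⟶ T.rootOp :=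
  (toHom g).cellN _ ≫ eqToHom (congrArg T.obj.node (fN_rootNode g))

theorem elN_rootNode (g : S ⟶ T) {x : P.B} (φ : x ⟶ S.rootOp) :
    (toHom g).elN ⟨S.rootNode, φ⟩ = ⟨T.rootNode, φ ≫ rootOpMap g⟩ :=
  El.mk_eq_iff.mpr ⟨fN_rootNode g, Category.assoc _ _ _⟩

theorem elM_rootMark (g : S ⟶ T) (e : P.Fibre S.rootOp) :
    (toHom g).elM (S.rootMark e) = T.rootMark ((P.fibreMap (rootOpMap g)).obj e) :=
  (toHom g).elM_markOf (elN_rootNode g _)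

theorem elA_input (g : S ⟶ T) (e : P.Fibre S.rootOp) :
    (toHom g).elA (S.input e) = T.input ((P.fibreMap (rootOpMap g)).obj e) := by
  rw [input, PTreeHom.elA_elS, elM_rootMark]

theorem fA_input (g : S ⟶ T) (e : P.Fibre S.rootOp) :
    (toHom g).fA (S.input e).1 = (T.input ((P.fibreMap (rootOpMap g)).obj e)).1 :=
  congrArg Sigma.fst (elA_input g e)

/-- The action of an isomorphism of dead trees on the root nodes and the subtrees above them. -/
def unglueMap (g : S ⟶ T) : EvalHom S.unglueObj T.unglueObj where
  base := rootOpMap g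
  cell e := subHom g (fA_input g e)
  natural {e e'} k := (subHom_comp (𝟙 S) g (S.input_fst k) (fA_input g e')).trans
    ((subHom_congr ((Category.id_comp g).trans (Category.comp_id g).symm) _ _).trans
      (subHom_comp g (𝟙 T) (fA_input g e)
        (T.input_fst ((P.fibreMap (rootOpMap g)).map k))).symm)
  compat e := (rootColour_subHom g ((elA_input g e).trans (El.pre_id _).symm)
    (fA_input g e)).trans (Category.comp_id _)

theorem rootOpMap_eq (g : S ⟶ T) {β : S.rootOp ⟶ T.rootOp}
    (h : (toHom g).elN ⟨S.rootNode, 𝟙 _⟩ = ⟨T.rootNode, β⟩) : rootOpMap g = β := by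
  rw [elN_rootNode, Category.id_comp] at h
  simpa using h

theorem rootOpMap_id : rootOpMap (𝟙 T) = 𝟙 _ := rootOpMap_eq _ (PTreeHom.elN_id _ _)

theorem rootOpMap_comp {U : DeadTree P} (g : S ⟶ T) (g' : T ⟶ U) :
    rootOpMap (g ≫ g') = rootOpMap g ≫ rootOpMap g' := by
  refine rootOpMap_eq _ ?_
  refine (PTreeHom.elN_comp (toHom g) (toHom g') _).trans ?_
  rw [elN_rootNode, elN_rootNode, Category.id_comp]

theorem unglueMap_id : unglueMap (𝟙 T) = EvalHom.id T.unglueObj :=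
  EvalHom.ext' rootOpMap_id fun e =>
    (subHom_comp (𝟙 T) (𝟙 T) (fA_input (𝟙 T) e) (T.input_fst (fibreCongr rootOpMap_id e))).trans
      (subHom_congr (Category.comp_id _) _ _)

theorem unglueMap_comp {U : DeadTree P} (g : S ⟶ T) (g' : T ⟶ U) :
    unglueMap (g ≫ g') = (unglueMap g).comp (unglueMap g') := by
  refine EvalHom.ext' (rootOpMap_comp g g') fun e => ?_
  refine (subHom_comp (g ≫ g') (𝟙 U) (fA_input (g ≫ g') e)
    (U.input_fst (fibreCongr (rootOpMap_comp g g') e))).trans ?_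
  have h1 := subHom_comp g' (𝟙 U) (fA_input g' ((P.fibreMap (rootOpMap g)).obj e))
    (U.input_fst (fibreMapComp (rootOpMap g) (rootOpMap g') e))
  refine Eq.trans ?_ (congrArg (subHom g (fA_input g e) ≫ ·) h1.symm)
  refine Eq.trans ?_ (subHom_comp g (g' ≫ 𝟙 U) (fA_input g e) _).symm
  exact subHom_congr (Category.assoc _ _ _) _ _

theorem rootColour_natural (g : S ⟶ T) :
    P.t.map (rootOpMap g) ≫ T.obj.isoT T.rootNode ≫ eqToHom (congrArg T.obj.edge T.t_rootNode) =
      (S.obj.isoT S.rootNode ≫ eqToHom (congrArg S.obj.edge S.t_rootNode)) ≫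
        (rootColour P).map g.hom := by
  have key : ∀ U : DeadTree P, U.obj.elT ⟨U.rootNode, 𝟙 U.rootOp⟩ = ⟨U.obj.tree.root,
      U.obj.isoT U.rootNode ≫ eqToHom (congrArg U.obj.edge U.t_rootNode)⟩ := fun U =>
    El.mk_eq_iff.mpr ⟨U.t_rootNode, by simp⟩
  have h := (toHom g).elA_elT ⟨S.rootNode, 𝟙 S.rootOp⟩
  rw [elN_rootNode, Category.id_comp, ← Category.comp_id (rootOpMap g), ← El.pre_mk,
    PTree.elT_pre, key, key, El.pre_mk] at h
  exact ((El.mk_eq_iff.mp h).2.symm.trans (Category.assoc _ _ _))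

/-- Every edge of a dead tree is the output edge of a node, and marks are determined by their nodes
through the pullback condition. -/
theorem hom_ext_elN {g g' : S ⟶ T}
    (h : ∀ n, (toHom g).elN ⟨n, 𝟙 (S.obj.node n)⟩ = (toHom g').elN ⟨n, 𝟙 _⟩) : g = g' := by
  have hN : ∀ {b} (a : El S.obj.node b), (toHom g).elN a = (toHom g').elN a := fun a => by
    rw [El.eq_pre a, PTreeHom.elN_pre, PTreeHom.elN_pre, h]
  refine ObjectProperty.hom_ext _ (PTreeHom.ext_el (fun a => ?_) (fun m => ?_) h)
  · obtain ⟨n, rfl⟩ := S.exists_t_eq a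
    have h1 := (toHom g).elA_elT ⟨n, 𝟙 (S.obj.node n)⟩
    rw [hN, ← PTreeHom.elA_elT, El.eq_pre (S.obj.elT _), PTreeHom.elA_pre, PTreeHom.elA_pre] at h1
    exact El.pre_injective _ h1
  · refine (T.obj.elP_bijective _).1 ?_
    rw [← PTreeHom.elN_elP, ← PTreeHom.elN_elP, hN]

theorem exists_rootMark_fst_eq {m : T.obj.tree.M}
    (h : T.obj.tree.t (T.obj.tree.p m) = T.obj.tree.root) :
    ∃ e : P.Fibre T.rootOp, (T.rootMark e).1 = m := by
  have hr : T.obj.tree.p m = T.rootNode := T.eq_rootNode h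
  refine ⟨CostructuredArrow.mk (Y := T.obj.mark m)
    (T.obj.isoP m ≫ eqToHom (congrArg T.obj.node hr)), ?_⟩
  have h1 : (⟨m, 𝟙 _⟩ : El T.obj.mark (T.obj.mark m)) = _ :=
    T.obj.eq_markOf (n := T.rootNode)
      (φ := T.obj.isoP m ≫ eqToHom (congrArg T.obj.node hr))
      (El.mk_eq_iff.mpr ⟨hr, by simp⟩)
  exact (congrArg Sigma.fst h1).symm

theorem exists_desc_input {a : T.obj.tree.A} (h : a ≠ T.obj.tree.root) :
    ∃ e, T.obj.tree.Desc a (T.input e).1 := by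
  obtain ⟨m, hm, hd⟩ := Tree.exists_desc_s (Tree.desc_root a) h
  obtain ⟨e, rfl⟩ := exists_rootMark_fst_eq hm
  exact ⟨e, hd⟩

theorem p_rootMark (e : P.Fibre T.rootOp) : T.obj.tree.p (T.rootMark e).1 = T.rootNode :=
  congrArg Sigma.fst (T.obj.elP_markOf T.rootNode e.hom)

theorem not_desc_root_input (e : P.Fibre T.rootOp) :
    ¬ T.obj.tree.Desc T.obj.tree.root (T.input e).1 := by
  refine Tree.not_desc_of_parent ⟨(T.rootMark e).1, rfl, ?_⟩
  rw [p_rootMark, t_rootNode]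

/-- A node is either the root node, where the action is the base of the arrow of `P(D)`, or it lies
in the subtree over an input, where the action is a cell. -/
theorem unglueMap_injective {g g' : S ⟶ T} (h : unglueMap g = unglueMap g') : g = g' := by
  have hb : rootOpMap g = rootOpMap g' := congrArg EvalHom.base h
  -- The bases of the two arrows are equal only propositionally, so their cells have different
  -- targets. They are compared in the subtree at a common edge `c`.
  have hc : ∀ e, ∃ (c : T.obj.tree.A) (h₁ : (toHom g).fA (S.input e).1 = c)
      (h₂ : (toHom g').fA (S.input e).1 = c), subHom g h₁ = subHom g' h₂ := by
    intro e
    have key : ∀ {q q' : EvalHom S.unglueObj T.unglueObj} (hq : q = q'),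
        q.cell e ≫ T.unglueObj.dec.map (fibreCongr (congrArg EvalHom.base hq) e) = q'.cell e := by
      rintro q _ rfl
      exact (congrArg (q.cell e ≫ ·) (T.unglueObj.dec.map_id _)).trans (Category.comp_id _)
    refine ⟨_, (fA_input g e).trans (T.input_fst (fibreCongr hb e)), fA_input g' e, ?_⟩
    refine Eq.trans ?_ (key h)
    refine Eq.trans ?_ (subHom_comp g (𝟙 T) (fA_input g e) (T.input_fst (fibreCongr hb e))).symm
    exact subHom_congr (Category.comp_id g).symm _ _
  refine hom_ext_elN fun n => ?_
  by_cases hn : S.obj.tree.t n = S.obj.tree.root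
  · obtain rfl := S.eq_rootNode hn
    rw [elN_rootNode, elN_rootNode, hb]
  · obtain ⟨e, he⟩ := exists_desc_input hn
    obtain ⟨c, h₁, h₂, h₃⟩ := hc e
    exact congrArg (fun q => T.obj.valN c
      ((toHom q).elN (⟨⟨n, he⟩, 𝟙 _⟩ : El (S.sub (S.input e).1).obj.node (S.obj.node n)))) h₃

theorem card_node_sub_input_lt (e : P.Fibre T.rootOp) :
    Nat.card (T.sub (T.input e).1).obj.tree.N < Nat.card T.obj.tree.N :=
  Finite.card_subtype_lt (x := T.rootNode) (by
    rw [t_rootNode]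
    exact not_desc_root_input e)

end DeadTree

/-- The decomposition of a dead tree into its root node and the subtrees above it. -/
def unglue (P : PolyEndo.{u, v} I) : SliceHom (deadTrees P) (P.obj (deadTrees P)) where
  functor :=
    { obj := fun T => DeadTree.unglueObj T
      map := fun g => DeadTree.unglueMap g
      map_id := fun _ => DeadTree.unglueMap_id
      map_comp := fun g g' => DeadTree.unglueMap_comp g g' }
  triangle T := T.obj.isoT (DeadTree.rootNode T) ≫
    eqToHom (congrArg T.obj.edge (DeadTree.t_rootNode T))
  natural g := DeadTree.rootColour_natural g

instance : (unglue P).functor.Faithful where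
  map_injective h := DeadTree.unglueMap_injective h

/-- Well-foundedness of the decomposition: the number of nodes bounds the height, because the
subtree over an input lacks the root node. -/
theorem exists_level_unglue (T : DeadTree P) : ∃ n, Level (unglue P) n T := by
  have key : ∀ n (T : DeadTree P), Nat.card T.obj.tree.N < n → Level (unglue P) n T := by
    intro n
    induction n with
    | zero => exact fun T h => absurd h (Nat.not_lt_zero _)
    | succ n ih =>
      intro T h e
      exact ih _ ((DeadTree.card_node_sub_input_lt e).trans_le (Nat.le_of_lt_succ h))
  exact ⟨_, key _ T (Nat.lt_succ_self _)⟩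

end

/-! ### Grafting of dead trees -/

namespace Tree

section
variable {K : Type} (T : K → Tree)

theorem reflTransGen_graft {k : K} {a c : (T k).A} (h : (T k).Desc a c) :
    Relation.ReflTransGen (Parent
      (Sum.elim (fun k => some ⟨k, (T k).root⟩) fun m : Σ k, (T k).M => some ⟨m.1, (T m.1).s m.2⟩)
      (Sum.elim (fun _ : K => none) fun m : Σ k, (T k).M => some ⟨m.1, (T m.1).p m.2⟩)
      (Option.map fun n : Σ k, (T k).N => (⟨n.1, (T n.1).t n.2⟩ : Σ k, (T k).A)))
      (some ⟨k, a⟩) (some ⟨k, c⟩) := by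
  refine Relation.ReflTransGen.lift (fun a => some (⟨k, a⟩ : Σ k, (T k).A)) ?_ _ _ h
  rintro _ _ ⟨m, rfl, rfl⟩
  exact ⟨Sum.inr ⟨k, m⟩, rfl, rfl⟩

theorem graft_s_injective : Function.Injective
    (Sum.elim (fun k => some ⟨k, (T k).root⟩) fun m : Σ k, (T k).M =>
      some (⟨m.1, (T m.1).s m.2⟩ : Σ k, (T k).A)) := by
  rintro (k | ⟨k, m⟩) (k' | ⟨k', m'⟩) h
  · obtain rfl : k = k' := congrArg Sigma.fst (Option.some.inj h)
    rfl
  · obtain rfl : k = k' := congrArg Sigma.fst (Option.some.inj h)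
    exact (root_ne_s m' (eq_of_heq (Sigma.mk.inj (Option.some.inj h)).2)).elim
  · obtain rfl : k = k' := congrArg Sigma.fst (Option.some.inj h)
    exact (root_ne_s m (eq_of_heq (Sigma.mk.inj (Option.some.inj h)).2).symm).elim
  · obtain rfl : k = k' := congrArg Sigma.fst (Option.some.inj h)
    obtain rfl : m = m' := (T k).s_injective (eq_of_heq (Sigma.mk.inj (Option.some.inj h)).2)
    rfl

variable [Finite K]

/-- The tree obtained by grafting the trees `T k` onto the inputs of a node. -/
def graft : Tree where
  -- In `A` and `N`, `none` is the new root edge and the new root node. The mark `inl k` makes the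
  -- root of `T k` an input of the new node.
  A := Option (Σ k, (T k).A)
  M := K ⊕ Σ k, (T k).M
  N := Option (Σ k, (T k).N)
  s := Sum.elim (fun k => some ⟨k, (T k).root⟩) fun m => some ⟨m.1, (T m.1).s m.2⟩
  p := Sum.elim (fun _ => none) fun m => some ⟨m.1, (T m.1).p m.2⟩
  t := Option.map fun n => ⟨n.1, (T n.1).t n.2⟩
  root := none
  t_injective := by
    refine Option.map_injective ?_
    rintro ⟨k, n⟩ ⟨k', n'⟩ h
    obtain rfl : k = k' := congrArg Sigma.fst h
    exact congrArg (Sigma.mk k) ((T k).t_injective (eq_of_heq (Sigma.mk.inj h).2))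
  s_injective := graft_s_injective T
  compl_range_s := by
    ext a
    constructor
    · intro h
      rcases a with _ | ⟨k, a⟩
      · rfl
      · refine (h ?_).elim
        by_cases ha : a = (T k).root
        · exact ⟨Sum.inl k, by rw [ha]; rfl⟩
        · obtain ⟨m, rfl⟩ := exists_s_eq ha
          exact ⟨Sum.inr ⟨k, m⟩, rfl⟩
    · rintro rfl ⟨k | m, h⟩
      · cases h
      · cases h
  walk_to_root a := by
    refine exists_walk_iterate_eq (graft_s_injective T) ?_
    rcases a with _ | ⟨k, a⟩
    · exact .refl
    · exact (reflTransGen_graft T (desc_root a)).tail ⟨Sum.inl k, rfl, rfl⟩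

variable {T}

theorem desc_graft {k : K} {a c : (T k).A} (h : (T k).Desc a c) :
    (graft T).Desc (some ⟨k, a⟩) (some ⟨k, c⟩) := reflTransGen_graft T h

/-- A mark whose node has its output edge in a branch lies in that branch, since the new marks lead
to `none`. Hence the subtree over a branch's root is no larger than the branch. -/
theorem exists_of_desc_graft {k : K} {b : (graft T).A} {c : (T k).A}
    (h : (graft T).Desc b (some ⟨k, c⟩)) : ∃ a, (T k).Desc a c ∧ b = some ⟨k, a⟩ := by
  induction h using Relation.ReflTransGen.head_induction_on with
  | refl => exact ⟨c, .refl c, rfl⟩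
  | head h _ ih =>
    obtain ⟨a, ha, rfl⟩ := ih
    obtain ⟨k' | ⟨k', m⟩, rfl, hm⟩ := h
    · cases hm
    · obtain rfl : k' = k := congrArg Sigma.fst (Option.some.inj hm)
      obtain rfl : (T k').t ((T k').p m) = a :=
        eq_of_heq (Sigma.mk.inj (Option.some.inj hm)).2
      exact ⟨_, (desc_s m).trans ha, rfl⟩

end
end Tree

/-! ### Grafting of decorated trees -/

section
variable {I : Type u} [Groupoid.{v} I] {P : PolyEndo.{u, v} I}

/-- The representatives are the images of the points of the finite set. An object of the fibre has
an arrow to only one of them, and only one such arrow, because the fibre is equivalent to a discrete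
category. Finiteness of their number makes the grafting a finite tree. -/
theorem exists_fibre_points (hP : P.HasFiniteDiscreteFibres) (b : P.B) :
    ∃ (n : ℕ) (pt : Fin n → P.Fibre b), ∀ e, Nonempty (Unique (El pt e)) := by
  obtain ⟨n, ⟨ε⟩⟩ := hP b
  refine ⟨n, fun k => ε.inverse.obj ⟨k⟩, fun e => ?_⟩
  refine ⟨⟨⟨(ε.functor.obj e).as, ε.unit.app e⟩⟩, ?_⟩
  rintro ⟨k, h⟩
  have hk : (ε.functor.obj e).as = k :=
    Discrete.eq_of_hom (ε.functor.map h ≫ ε.counit.app ⟨k⟩)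
  subst hk
  have hs : ∀ h' h'' : e ⟶ ε.inverse.obj ⟨(ε.functor.obj e).as⟩, h' = h'' := fun h' h'' =>
    ε.functor.map_injective (Subsingleton.elim _ _)
  rw [hs h]
  rfl

/-- An object of `P(D)`, with representatives of the isomorphism classes of inputs. -/
structure Graftable (P : PolyEndo.{u, v} I) where
  obj : P.EvalObj (deadTrees P)
  K : Type
  [finK : Finite K]
  pt : K → P.Fibre obj.op
  uniq : ∀ e, Nonempty (Unique (El pt e))

attribute [instance] Graftable.finK

namespace Graftable

variable (S : Graftable P)

/-- The representative of the isomorphism class of an input. -/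
def rep (e : P.Fibre S.obj.op) : El S.pt e := (S.uniq e).some.default

variable {S} in
theorem eq_rep {e : P.Fibre S.obj.op} (a : El S.pt e) : a = S.rep e := (S.uniq e).some.uniq a

/-- The dead tree at a representative of inputs. -/
abbrev branch (k : S.K) : DeadTree P := S.obj.dec.obj (S.pt k)

/-- Both arrows start at one and the same object of the fibre, which has a single arrow to a single
representative. -/
theorem homMk_fst_eq {k : S.K} {x : P.E} (h : x ⟶ (S.pt k).left) (k' : S.K)
    (h' : x ⟶ (S.pt k').left)
    (e : P.p.map h ≫ (S.pt k).hom = P.p.map h' ≫ (S.pt k').hom) :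
    (⟨k, h⟩ : El (fun k => (S.pt k).left) x) = ⟨k', h'⟩ := by
  let z : P.Fibre S.obj.op := CostructuredArrow.mk (P.p.map h' ≫ (S.pt k').hom)
  let q : z ⟶ S.pt k := CostructuredArrow.homMk h e
  let q' : z ⟶ S.pt k' := CostructuredArrow.homMk h' rfl
  have hq : (⟨k, q⟩ : El S.pt z) = ⟨k', q'⟩ := (eq_rep _).trans (eq_rep _).symm
  exact congrArg (fun a : El S.pt z => (⟨a.1, a.2.left⟩ : El (fun k => (S.pt k).left) x)) hq

/-- The decoration of the edges of the grafting. -/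
def edge : Option (Σ k, (S.branch k).obj.tree.A) → I
  | none => P.t.obj S.obj.op
  | some a => (S.branch a.1).obj.edge a.2

/-- The decoration of the marks of the grafting. -/
def mark : (S.K ⊕ Σ k, (S.branch k).obj.tree.M) → P.E
  | .inl k => (S.pt k).left
  | .inr m => (S.branch m.1).obj.mark m.2

/-- The decoration of the nodes of the grafting. -/
def node : Option (Σ k, (S.branch k).obj.tree.N) → P.B
  | none => S.obj.op
  | some n => (S.branch n.1).obj.node n.2

/-- The isomorphisms filling the middle square of the grafting. -/
def isoP : ∀ m, P.p.obj (S.mark m) ⟶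
    S.node ((Tree.graft fun k => (S.branch k).obj.tree).p m)
  | .inl k => (S.pt k).hom
  | .inr m => (S.branch m.1).obj.isoP m.2

/-- Over the new root node the pullback condition is the existence and uniqueness of the arrow to a
representative; over the other nodes it is that of the branch. -/
theorem mapAlong_isoP_bijective (x : P.E) :
    Function.Bijective (El.mapAlong (x := x) P.p _ S.isoP) := by
  constructor
  · rintro ⟨k | ⟨k, m⟩, h⟩ ⟨k' | ⟨k', m'⟩, h'⟩ e
    · obtain ⟨_, e₂⟩ := El.mk_eq_iff.mp e
      have := S.homMk_fst_eq h k' h' ((Category.comp_id _).symm.trans e₂)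
      exact congrArg (fun a : El (fun k => (S.pt k).left) x => (⟨.inl a.1, a.2⟩ : El S.mark x)) this
    · exact nomatch congrArg Sigma.fst e
    · exact nomatch congrArg Sigma.fst e
    · obtain ⟨e₁, e₂⟩ := El.mk_eq_iff.mp e
      obtain rfl : k = k' := congrArg Sigma.fst (Option.some.inj e₁)
      have := ((S.branch k).obj.elP_bijective x).1 (a₁ := ⟨m, h⟩) (a₂ := ⟨m', h'⟩)
        (El.mk_eq_iff.mpr ⟨eq_of_heq (Sigma.mk.inj (Option.some.inj e₁)).2, e₂⟩)
      exact congrArg (fun a : El (S.branch k).obj.mark x =>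
        (⟨.inr ⟨k, a.1⟩, a.2⟩ : El S.mark x)) this
  · rintro ⟨_ | ⟨k, n⟩, φ⟩
    · let z : P.Fibre S.obj.op := CostructuredArrow.mk φ
      exact ⟨⟨.inl (S.rep z).1, (S.rep z).2.left⟩,
        congrArg (Sigma.mk none) (CostructuredArrow.w (S.rep z).2)⟩
    · obtain ⟨a, ha⟩ := ((S.branch k).obj.elP_bijective x).2 ⟨n, φ⟩
      exact ⟨⟨.inr ⟨k, a.1⟩, a.2⟩, congrArg (fun a : El (S.branch k).obj.node _ =>
        (⟨some ⟨k, a.1⟩, a.2⟩ : El S.node _)) ha⟩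

/-- Grafting of dead trees, as a `P`-tree. -/
def tree : PTree P where
  tree := Tree.graft fun k => (S.branch k).obj.tree
  edge := S.edge
  mark := S.mark
  node := S.node
  isoS
    | .inl k => Groupoid.inv (S.obj.triangle (S.pt k))
    | .inr m => (S.branch m.1).obj.isoS m.2
  isoP := S.isoP
  isoT
    | none => 𝟙 (P.t.obj S.obj.op)
    | some n => (S.branch n.1).obj.isoT n.2
  pullback := (isEquivalence_discrete_comma_iff P.p S.mark S.node _ S.isoP).mpr
    S.mapAlong_isoP_bijective

/-- Grafting of dead trees. -/
def graft : DeadTree P where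
  obj := S.tree
  property := by
    refine Set.eq_empty_of_forall_notMem ?_
    rintro (_ | ⟨k, a⟩) h
    · exact h ⟨none, rfl⟩
    · obtain ⟨n, rfl⟩ := (S.branch k).exists_t_eq a
      exact h ⟨some ⟨k, n⟩, rfl⟩

/-- The isomorphism from a branch to the subtree above the corresponding input of the root node. -/
def branchPTreeHom (k : S.K) : PTreeHom (S.branch k).obj
    (S.graft.obj.sub (some ⟨k, (S.branch k).obj.tree.root⟩)) where
  fA := Equiv.ofBijective (fun a => ⟨some ⟨k, a⟩, Tree.desc_graft (Tree.desc_root a)⟩) <| by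
    constructor
    · intro a a' h
      exact eq_of_heq (Sigma.mk.inj (Option.some.inj (congrArg Subtype.val h))).2
    · rintro ⟨b, hb⟩
      obtain ⟨a, _, rfl⟩ := Tree.exists_of_desc_graft hb
      exact ⟨a, rfl⟩
  fN := Equiv.ofBijective (fun n => ⟨some ⟨k, n⟩, Tree.desc_graft (Tree.desc_root _)⟩) <| by
    constructor
    · intro a a' h
      exact eq_of_heq (Sigma.mk.inj (Option.some.inj (congrArg Subtype.val h))).2
    · rintro ⟨_ | ⟨k', n⟩, hb⟩
      · obtain ⟨a, _, h⟩ := Tree.exists_of_desc_graft hb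
        exact nomatch h
      · obtain ⟨a, _, h⟩ := Tree.exists_of_desc_graft hb
        obtain rfl : k' = k := congrArg Sigma.fst (Option.some.inj h)
        exact ⟨n, rfl⟩
  fM := Equiv.ofBijective (fun m => ⟨.inr ⟨k, m⟩, Tree.desc_graft (Tree.desc_root _)⟩) <| by
    constructor
    · intro a a' h
      exact eq_of_heq (Sigma.mk.inj (Sum.inr.inj (congrArg Subtype.val h))).2
    · rintro ⟨k' | ⟨k', n⟩, hb⟩
      · obtain ⟨a, _, h⟩ := Tree.exists_of_desc_graft hb
        exact nomatch h
      · obtain ⟨a, _, h⟩ := Tree.exists_of_desc_graft hb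
        obtain rfl : k' = k := congrArg Sigma.fst (Option.some.inj h)
        exact ⟨n, rfl⟩
  comm_s _ := rfl
  comm_p _ := rfl
  comm_t _ := rfl
  cellA a := 𝟙 ((S.branch k).obj.edge a)
  cellM m := 𝟙 ((S.branch k).obj.mark m)
  cellN n := 𝟙 ((S.branch k).obj.node n)
  compat_s m := by
    change (S.branch k).obj.isoS m ≫ 𝟙 _ ≫ 𝟙 _ = P.s.map (𝟙 _) ≫ (S.branch k).obj.isoS m
    simp
  compat_p m := by
    change (S.branch k).obj.isoP m ≫ 𝟙 _ ≫ 𝟙 _ = P.p.map (𝟙 _) ≫ (S.branch k).obj.isoP m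
    simp
  compat_t m := by
    change (S.branch k).obj.isoT m ≫ 𝟙 _ ≫ 𝟙 _ = P.t.map (𝟙 _) ≫ (S.branch k).obj.isoT m
    simp

/-- The isomorphism from a branch to the subtree above the corresponding input of the root node. -/
def branchHom (k : S.K) {c : S.graft.obj.tree.A}
    (hc : (some ⟨k, (S.branch k).obj.tree.root⟩ : S.graft.obj.tree.A) = c) :
    S.branch k ⟶ S.graft.sub c :=
  ObjectProperty.homMk (S.branchPTreeHom k) ≫ DeadTree.subHom (𝟙 S.graft) hc

theorem branchHom_comp (k : S.K) {c c' : S.graft.obj.tree.A}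
    (hc : (some ⟨k, (S.branch k).obj.tree.root⟩ : S.graft.obj.tree.A) = c)
    (hc' : (some ⟨k, (S.branch k).obj.tree.root⟩ : S.graft.obj.tree.A) = c')
    (h : (DeadTree.toHom (𝟙 S.graft)).fA c = c') :
    S.branchHom k hc ≫ DeadTree.subHom (𝟙 S.graft) h = S.branchHom k hc' := by
  subst hc hc'
  exact Category.comp_id _

/-- `rootNode` comes from a choice, so it is not `none` by definition; `opHom` absorbs the resulting
transport. -/
theorem rootNode_graft : none = S.graft.rootNode := S.graft.eq_rootNode rfl

/-- The operation of an object of `P(D)` decorates the root node of its grafting. -/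
def opHom : S.obj.op ⟶ S.graft.rootOp := eqToHom (congrArg S.node S.rootNode_graft)

theorem mk_opHom {x : P.B} (φ : x ⟶ S.obj.op) :
    (⟨none, φ⟩ : El S.graft.obj.node x) = ⟨S.graft.rootNode, φ ≫ S.opHom⟩ :=
  El.mk_eq_iff (f := S.graft.obj.node).mpr ⟨S.rootNode_graft, rfl⟩

theorem rootMark_graft {e : P.Fibre S.obj.op} (a : El S.pt e) :
    (⟨.inl a.1, a.2.left⟩ : El S.graft.obj.mark e.left) =
      S.graft.rootMark ((P.fibreMap S.opHom).obj e) := by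
  refine S.graft.obj.eq_markOf (Eq.trans ?_ (S.mk_opHom e.hom))
  exact congrArg (Sigma.mk none) (CostructuredArrow.w a.2)

theorem input_graft {e : P.Fibre S.obj.op} (a : El S.pt e) :
    S.graft.input ((P.fibreMap S.opHom).obj e) =
      ⟨some ⟨a.1, (S.branch a.1).obj.tree.root⟩,
        P.s.map a.2.left ≫ Groupoid.inv (S.obj.triangle (S.pt a.1))⟩ :=
  congrArg S.graft.obj.elS (S.rootMark_graft a).symm

theorem input_graft_fst {e : P.Fibre S.obj.op} (a : El S.pt e) :
    (some ⟨a.1, (S.branch a.1).obj.tree.root⟩ : S.graft.obj.tree.A) =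
      (S.graft.input ((P.fibreMap S.opHom).obj e)).1 :=
  (congrArg Sigma.fst (S.input_graft a)).symm

/-- The component of the comparison of an object of `P(D)` with the decomposition of its
grafting. -/
def unitCell (e : P.Fibre S.obj.op) :
    S.obj.dec.obj e ⟶ S.graft.unglueObj.dec.obj ((P.fibreMap S.opHom).obj e) :=
  S.obj.dec.map (S.rep e).2 ≫ S.branchHom (S.rep e).1 (S.input_graft_fst (S.rep e))

theorem unitCell_eq {e : P.Fibre S.obj.op} (a : El S.pt e) :
    S.unitCell e = S.obj.dec.map a.2 ≫ S.branchHom a.1 (S.input_graft_fst a) := by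
  obtain rfl := eq_rep a
  rfl

theorem rootColour_branchHom (k : S.K) {x : I} {a : El S.graft.obj.edge x}
    {h : x ⟶ (S.branch k).obj.edge (S.branch k).obj.tree.root}
    (ha : a = ⟨some ⟨k, (S.branch k).obj.tree.root⟩, h⟩)
    (hc : (some ⟨k, (S.branch k).obj.tree.root⟩ : S.graft.obj.tree.A) = a.1) :
    (deadTrees P).proj.map (S.branchHom k hc) ≫ Groupoid.inv a.2 = Groupoid.inv h := by
  subst ha
  have h1 : (deadTrees P).proj.map (S.branchHom k rfl) =
      𝟙 ((S.branch k).obj.edge (S.branch k).obj.tree.root) :=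
    (congrArg (deadTrees P).proj.map (Category.comp_id _)).trans (Category.comp_id (𝟙 _))
  exact (congrArg (· ≫ Groupoid.inv h) h1).trans (Category.id_comp _)

/-- The comparison of an object of `P(D)` with the decomposition of its grafting. -/
def unit : EvalHom S.obj S.graft.unglueObj where
  base := S.opHom
  cell := S.unitCell
  natural {e e'} k := by
    -- The arrow from `e'` to its representative, preceded by `k`, is the arrow from `e` to its own,
    -- so the cell at `e` can be computed with it.
    refine Eq.trans ?_ (congrArg (· ≫ _) (S.unitCell_eq (El.pre k (S.rep e'))).symm)
    refine (Category.assoc _ _ _).symm.trans ?_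
    refine (congrArg (· ≫ _) (S.obj.dec.map_comp _ _).symm).trans ?_
    refine Eq.trans ?_ (Category.assoc _ _ _).symm
    exact congrArg (_ ≫ ·) (S.branchHom_comp _ _ _ _).symm
  compat e := by
    have h1 := S.obj.natural (S.rep e).2
    have h2 := S.rootColour_branchHom (S.rep e).1 (S.input_graft (S.rep e))
      (S.input_graft_fst (S.rep e))
    refine (congrArg (· ≫ _) (Functor.map_comp _ _ _)).trans ((Category.assoc _ _ _).trans ?_)
    refine (congrArg (_ ≫ ·) h2).trans ?_
    have h3 : Groupoid.inv (P.s.map (S.rep e).2.left ≫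
        Groupoid.inv (S.obj.triangle (S.pt (S.rep e).1))) =
      S.obj.triangle (S.pt (S.rep e).1) ≫ Groupoid.inv (P.s.map (S.rep e).2.left) := by
      simp [Groupoid.inv_eq_inv]
    refine (congrArg (_ ≫ ·) h3).trans ((Category.assoc _ _ _).symm.trans ?_)
    refine (congrArg (· ≫ _) h1).trans ((Category.assoc _ _ _).trans ?_)
    exact (congrArg (_ ≫ ·) (Groupoid.comp_inv _)).trans (Category.comp_id _)

end Graftable
end

/-! ### The universal property of grafting -/

theorem inv_comp_of_comp_inv {C : Type*} [Groupoid C] {a b c : C} {f : a ⟶ b} {g : c ⟶ b}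
    {h : a ⟶ c} (e : f ≫ Groupoid.inv g = h) : Groupoid.inv h ≫ f = g := by
  subst e
  simp [Groupoid.inv_eq_inv]

section
variable {I : Type u} [Groupoid.{v} I] {P : PolyEndo.{u, v} I}

namespace PTreeHom

variable {S T : PTree P} (g : PTreeHom S T)

theorem pre_elA_s (m : S.tree.M) :
    El.pre (S.isoS m) (g.elA ⟨S.tree.s m, 𝟙 _⟩) = T.elS (g.elM ⟨m, 𝟙 _⟩) := by
  rw [← elA_elS, ← elA_pre]
  exact congrArg (fun f => g.elA ⟨S.tree.s m, f⟩) (by simp)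

theorem pre_elN_p (m : S.tree.M) :
    El.pre (S.isoP m) (g.elN ⟨S.tree.p m, 𝟙 _⟩) = T.elP (g.elM ⟨m, 𝟙 _⟩) := by
  rw [← elN_elP, ← elN_pre]
  exact congrArg (fun f => g.elN ⟨S.tree.p m, f⟩) (by simp)

theorem pre_elA_t (n : S.tree.N) :
    El.pre (S.isoT n) (g.elA ⟨S.tree.t n, 𝟙 _⟩) = T.elT (g.elN ⟨n, 𝟙 _⟩) := by
  rw [← elA_elT, ← elA_pre]
  exact congrArg (fun f => g.elA ⟨S.tree.t n, f⟩) (by simp)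

end PTreeHom

namespace DeadTree

/-- An isomorphism of dead trees from its action on elements; only the bijectivity on edges has to
be checked. -/
def ofEl {S T : DeadTree P} (α : ∀ a, El T.obj.edge (S.obj.edge a))
    (μ : ∀ a, El T.obj.mark (S.obj.mark a)) (ν : ∀ a, El T.obj.node (S.obj.node a))
    (hα : Function.Bijective fun a => (α a).1)
    (hr : (α S.obj.tree.root).1 = T.obj.tree.root)
    (hs : ∀ m, El.pre (S.obj.isoS m) (α (S.obj.tree.s m)) = T.obj.elS (μ m))
    (hp : ∀ m, El.pre (S.obj.isoP m) (ν (S.obj.tree.p m)) = T.obj.elP (μ m))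
    (ht : ∀ n, El.pre (S.obj.isoT n) (α (S.obj.tree.t n)) = T.obj.elT (ν n)) : S ⟶ T := by
  have hs' : ∀ m, (α (S.obj.tree.s m)).1 = T.obj.tree.s (μ m).1 := fun m =>
    congrArg Sigma.fst (hs m)
  have ht' : ∀ n, (α (S.obj.tree.t n)).1 = T.obj.tree.t (ν n).1 := fun n =>
    congrArg Sigma.fst (ht n)
  -- Marks correspond through `s` to the edges other than the root, and nodes through `t` to all
  -- edges, the trees being dead. Both bijections thus come from the one on edges.
  refine ObjectProperty.homMk (PTreeHom.ofEl α μ ν hα ⟨fun m m' h => ?_, fun m' => ?_⟩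
    ⟨fun n n' h => ?_, fun n' => ?_⟩ hs hp ht)
  · refine S.obj.tree.s_injective (hα.1 ((hs' m).trans (Eq.trans ?_ (hs' m').symm)))
    exact congrArg T.obj.tree.s h
  · obtain ⟨a, ha⟩ := hα.2 (T.obj.tree.s m')
    obtain ⟨m, rfl⟩ : ∃ m, S.obj.tree.s m = a := by
      refine Tree.exists_s_eq ?_
      rintro rfl
      exact Tree.root_ne_s m' (hr.symm.trans ha)
    exact ⟨m, T.obj.tree.s_injective ((hs' m).symm.trans ha)⟩
  · refine S.obj.tree.t_injective (hα.1 ((ht' n).trans (Eq.trans ?_ (ht' n').symm)))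
    exact congrArg T.obj.tree.t h
  · obtain ⟨a, ha⟩ := hα.2 (T.obj.tree.t n')
    obtain ⟨n, rfl⟩ := S.exists_t_eq a
    exact ⟨n, T.obj.tree.t_injective ((ht' n).symm.trans ha)⟩

/-- Both inputs have an arrow to the decoration of the same mark; one arrow followed by the inverse
of the other connects them, and `elP` shows that it lies over the operation. -/
theorem fibre_hom_of_rootMark_fst_eq {T : DeadTree P} {e e' : P.Fibre T.rootOp}
    (h : (T.rootMark e).1 = (T.rootMark e').1) :
    ∃ k : e.left ⟶ e'.left, P.p.map k ≫ e'.hom = e.hom := by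
  obtain ⟨k, hk⟩ : ∃ k : e.left ⟶ e'.left, El.pre k (T.rootMark e') = T.rootMark e := by
    refine ⟨((T.rootMark e).2 ≫ eqToHom (congrArg T.obj.mark h)) ≫
      Groupoid.inv (T.rootMark e').2, ?_⟩
    refine (El.mk_eq_iff.mpr ⟨h, ?_⟩).symm
    rw [Category.assoc _ (Groupoid.inv _), Groupoid.inv_comp, Category.comp_id]
    rfl
  refine ⟨k, ?_⟩
  have h1 := congrArg T.obj.elP hk
  rw [PTree.elP_pre, PTree.elP_markOf, PTree.elP_markOf, El.pre_mk] at h1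
  simpa using h1

end DeadTree

/-! ### The arrow out of a grafting -/

namespace Graftable

variable (S : Graftable P) {T : DeadTree P} (g : EvalHom S.obj T.unglueObj)

/-- The restriction to a branch of an arrow to the decomposition of a dead tree. -/
abbrev branchMap (k : S.K) :
    S.branch k ⟶ T.sub (T.input ((P.fibreMap g.base).obj (S.pt k))).1 :=
  g.cell (S.pt k)

/-- The action on edges of the arrow out of a grafting. -/
def liftA : ∀ a, El T.obj.edge (S.edge a)
  | none => T.obj.elT ⟨T.rootNode, g.base⟩
  | some a => T.obj.valA _ ((DeadTree.toHom (S.branchMap g a.1)).elA ⟨a.2, 𝟙 _⟩)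

/-- The action on marks of the arrow out of a grafting. -/
def liftM : ∀ a, El T.obj.mark (S.mark a)
  | .inl k => T.rootMark ((P.fibreMap g.base).obj (S.pt k))
  | .inr a => T.obj.valM _ ((DeadTree.toHom (S.branchMap g a.1)).elM ⟨a.2, 𝟙 _⟩)

/-- The action on nodes of the arrow out of a grafting. -/
def liftN : ∀ a, El T.obj.node (S.node a)
  | none => ⟨T.rootNode, g.base⟩
  | some a => T.obj.valN _ ((DeadTree.toHom (S.branchMap g a.1)).elN ⟨a.2, 𝟙 _⟩)

theorem desc_liftA (k : S.K) (a : (S.branch k).obj.tree.A) :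
    T.obj.tree.Desc (S.liftA g (some ⟨k, a⟩)).1
      (T.input ((P.fibreMap g.base).obj (S.pt k))).1 :=
  ((DeadTree.toHom (S.branchMap g k)).fA a).2

theorem liftA_root : (S.liftA g none).1 = T.obj.tree.root := T.t_rootNode

/-- The edges of `T` other than the root are partitioned by the input edges of the root node, and
each branch is mapped isomorphically onto one part. -/
theorem liftA_bijective : Function.Bijective fun a => (S.liftA g a).1 := by
  constructor
  · have hne : ∀ a, (S.liftA g none).1 ≠ (S.liftA g (some a)).1 := fun a h => by
      refine DeadTree.not_desc_root_input ((P.fibreMap g.base).obj (S.pt a.1)) ?_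
      rw [← S.liftA_root g, h]
      exact S.desc_liftA g a.1 a.2
    rintro (_ | ⟨k, a⟩) (_ | ⟨k', a'⟩) h
    · rfl
    · exact (hne _ h).elim
    · exact (hne _ h.symm).elim
    · have h1 := S.desc_liftA g k a
      have h2 := S.desc_liftA g k' a'
      have h' : (S.liftA g (some ⟨k, a⟩)).1 = (S.liftA g (some ⟨k', a'⟩)).1 := h
      rw [h'] at h1
      -- Disjointness of the subtrees makes the two inputs share a mark. They are then joined by an
      -- arrow of the fibre, so that their representatives coincide.
      have h3 := Tree.eq_of_desc_s ((DeadTree.p_rootMark _).trans (DeadTree.p_rootMark _).symm) h1 h2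
      obtain ⟨q, hq⟩ := DeadTree.fibre_hom_of_rootMark_fst_eq h3
      have hq' : P.p.map q ≫ (S.pt k').hom = P.p.map (𝟙 _) ≫ (S.pt k).hom := by
        rw [CategoryTheory.Functor.map_id, Category.id_comp]
        exact (cancel_mono g.base).mp ((Category.assoc _ _ _).trans hq)
      obtain rfl : k' = k := congrArg Sigma.fst (S.homMk_fst_eq q k (𝟙 _) hq')
      obtain rfl : a = a' := (DeadTree.toHom (S.branchMap g k')).fA.injective (Subtype.ext h')
      rfl
  · intro b
    by_cases hb : b = T.obj.tree.root
    · exact ⟨none, (S.liftA_root g).trans hb.symm⟩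
    · obtain ⟨e, he⟩ := DeadTree.exists_desc_input hb
      -- The branch that covers `b` is found by pulling its input back along the base of `g` and
      -- passing to the representative.
      let a := S.rep ((P.fibreMap (Groupoid.inv g.base)).obj e)
      have h := T.input_fst (fibreMapInv g.base e ≫ (P.fibreMap g.base).map a.2)
      rw [h] at he
      obtain ⟨z, hz⟩ := (DeadTree.toHom (S.branchMap g a.1)).fA.surjective ⟨b, he⟩
      exact ⟨some ⟨a.1, z⟩, congrArg Subtype.val hz⟩

/-- The `s`-square at the new marks: it expresses the compatibility of `g` with the maps to `I`. -/
theorem pre_liftA_root (k : S.K) :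
    El.pre (Groupoid.inv (S.obj.triangle (S.pt k)))
      (S.liftA g (some ⟨k, (S.branch k).obj.tree.root⟩)) =
        T.input ((P.fibreMap g.base).obj (S.pt k)) := by
  have h : (rootColour P).map (S.branchMap g k).hom ≫ Groupoid.inv
      (T.input ((P.fibreMap g.base).obj (S.pt k))).2 = S.obj.triangle (S.pt k) :=
    g.compat (S.pt k)
  have hr := (DeadTree.toHom (S.branchMap g k)).map_root
  have h2 : S.liftA g (some ⟨k, (S.branch k).obj.tree.root⟩) =
      ⟨(T.input ((P.fibreMap g.base).obj (S.pt k))).1,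
        (rootColour P).map (S.branchMap g k).hom⟩ := by
    refine El.mk_eq_iff.mpr ⟨congrArg Subtype.val hr, ?_⟩
    exact congrArg (· ≫ _) (Category.id_comp _)
  refine (congrArg (El.pre _) h2).trans (congrArg (Sigma.mk _) ?_)
  exact inv_comp_of_comp_inv h

/-- The arrow out of a grafting given by an arrow to the decomposition of a dead tree. -/
def lift : S.graft ⟶ T :=
  DeadTree.ofEl (S.liftA g) (S.liftM g) (S.liftN g) (S.liftA_bijective g) (S.liftA_root g)
    (by
      rintro (k | ⟨k, m⟩)
      · exact S.pre_liftA_root g k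
      · exact congrArg (T.obj.valA _) ((DeadTree.toHom (S.branchMap g k)).pre_elA_s m))
    (by
      rintro (k | ⟨k, m⟩)
      · exact (T.obj.elP_markOf _ _).symm
      · exact congrArg (T.obj.valN _) ((DeadTree.toHom (S.branchMap g k)).pre_elN_p m))
    (by
      rintro (_ | ⟨k, n⟩)
      · exact El.pre_id _
      · exact congrArg (T.obj.valA _) ((DeadTree.toHom (S.branchMap g k)).pre_elA_t n))

theorem valN_branchHom (k : S.K) {c : S.graft.obj.tree.A}
    (hc : (some ⟨k, (S.branch k).obj.tree.root⟩ : S.graft.obj.tree.A) = c) {x : P.B}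
    (a : El (S.branch k).obj.node x) :
    S.graft.obj.valN c ((DeadTree.toHom (S.branchHom k hc)).elN a) =
      (⟨some ⟨k, a.1⟩, a.2⟩ : El S.graft.obj.node x) := by
  subst hc
  exact congrArg (Sigma.mk (some (⟨k, a.1⟩ : Σ k, (S.branch k).obj.tree.N)))
    ((congrArg (a.2 ≫ ·) (Category.comp_id _)).trans (Category.comp_id _))

theorem elN_lift (n : S.graft.obj.tree.N) :
    (DeadTree.toHom (S.lift g)).elN ⟨n, 𝟙 (S.graft.obj.node n)⟩ = S.liftN g n :=
  El.pre_id _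

theorem rootOpMap_lift : S.opHom ≫ DeadTree.rootOpMap (S.lift g) = g.base := by
  have h := DeadTree.elN_rootNode (S.lift g) S.opHom
  have h1 := S.mk_opHom (𝟙 S.obj.op)
  rw [Category.id_comp] at h1
  rw [← h1] at h
  have h2 := (S.elN_lift g none).symm.trans h
  exact (eq_of_heq (Sigma.mk.inj h2).2).symm

/-- The edges `c` and `c'` are left free so that the equalities can be substituted. The claim is
then tested on nodes, where `lift` is defined on a branch as the cell of `g`. -/
theorem branchHom_subHom_lift (k : S.K) {c : S.graft.obj.tree.A} {c' : T.obj.tree.A}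
    (hc : (some ⟨k, (S.branch k).obj.tree.root⟩ : S.graft.obj.tree.A) = c)
    (h : (DeadTree.toHom (S.lift g)).fA c = c')
    (h' : (T.input ((P.fibreMap g.base).obj (S.pt k))).1 = c') :
    S.branchHom k hc ≫ DeadTree.subHom (S.lift g) h =
      S.branchMap g k ≫ DeadTree.subHom (𝟙 T) h' := by
  subst hc h'
  refine Eq.trans ?_ (Category.comp_id (S.branchMap g k)).symm
  refine DeadTree.hom_ext_elN fun n => T.obj.valN_injective _ ?_
  have h1 := PTreeHom.elN_comp (DeadTree.toHom (S.branchHom k rfl))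
    (DeadTree.toHom (DeadTree.subHom (S.lift g) h)) ⟨n, 𝟙 _⟩
  refine (congrArg (T.obj.valN _) h1).trans ?_
  refine Eq.trans ?_ (S.elN_lift g (some ⟨k, n⟩))
  exact congrArg (DeadTree.toHom (S.lift g)).elN (S.valN_branchHom k rfl ⟨n, 𝟙 _⟩)

theorem unit_comp_lift : S.unit.comp (DeadTree.unglueMap (S.lift g)) = g := by
  refine EvalHom.ext' (S.rootOpMap_lift g) fun e => ?_
  let k := (S.rep e).1
  let γ := S.lift g
  have h1 : ∀ {c : T.obj.tree.A} (h : (DeadTree.toHom γ).fA _ = c)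
      (h' : (T.input ((P.fibreMap g.base).obj (S.pt k))).1 = c),
      S.unitCell e ≫ DeadTree.subHom γ h =
        S.obj.dec.map (S.rep e).2 ≫ S.branchMap g k ≫ DeadTree.subHom (𝟙 T) h' := fun h h' =>
    (Category.assoc _ _ _).trans (congrArg (_ ≫ ·) (S.branchHom_subHom_lift g k _ h h'))
  have h2 : ∀ {c c' c'' : T.obj.tree.A} (h : (DeadTree.toHom γ).fA _ = c) (h' : c = c')
      (h'' : c' = c''), (S.unitCell e ≫ DeadTree.subHom γ h ≫ DeadTree.subHom (𝟙 T) h') ≫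
        DeadTree.subHom (𝟙 T) h'' = S.unitCell e ≫ DeadTree.subHom γ (h.trans (h'.trans h'')) := by
    rintro c _ _ h rfl rfl
    exact (Category.comp_id _).trans (congrArg (_ ≫ ·) (Category.comp_id _))
  refine (h2 (DeadTree.fA_input γ _) (T.input_fst (fibreMapComp _ _ e))
    (T.input_fst (fibreCongr (S.rootOpMap_lift g) e))).trans ?_
  refine (h1 _ (T.input_fst ((P.fibreMap g.base).map (S.rep e).2)).symm).trans ?_
  have h3 : ∀ {c c' : T.obj.tree.A} (h : c = c') (h' : c' = c),
      DeadTree.subHom (𝟙 T) h ≫ DeadTree.subHom (𝟙 T) h' = 𝟙 (T.sub c) := by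
    rintro c _ rfl _
    exact Category.comp_id _
  -- Naturality of `g` exchanges the cell at the representative for the cell at `e`, up to two
  -- restrictions of the identity of `T` that cancel.
  refine (Category.assoc _ _ _).symm.trans ((congrArg (· ≫ _) (g.natural (S.rep e).2)).trans ?_)
  refine (Category.assoc _ _ _).trans ((congrArg (g.cell e ≫ ·) (h3 _ _)).trans ?_)
  exact Category.comp_id _

end Graftable

/-- Existence of the factorisation is enough: its uniqueness is the faithfulness already known. -/
theorem exists_universal_grafting (hP : P.HasFiniteDiscreteFibres)
    (X : P.EvalObj (deadTrees P)) :
    ∃ (G : (deadTrees P).carrier) (u : X ⟶ (unglue P).functor.obj G),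
      ∀ (T : (deadTrees P).carrier) (g : X ⟶ (unglue P).functor.obj T),
        ∃ γ : G ⟶ T, u ≫ (unglue P).functor.map γ = g := by
  obtain ⟨n, pt, h⟩ := exists_fibre_points hP X.op
  let S : Graftable P := ⟨X, Fin n, pt, h⟩
  exact ⟨S.graft, S.unit, fun T g => ⟨S.lift g, S.unit_comp_lift g⟩⟩

theorem isEquivalence_unglue (hP : P.HasFiniteDiscreteFibres) :
    (unglue P).functor.IsEquivalence := by
  have : (unglue P).functor.Full := by
    refine ⟨fun {T T'} g => ?_⟩
    obtain ⟨G, u, hu⟩ := exists_universal_grafting hP ((unglue P).functor.obj T)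
    -- Factoring the identity shows that the image of `γ` is inverse to `u`. If `γ'` factors `g`,
    -- then `γ⁻¹ ≫ γ'` is mapped to `g`.
    obtain ⟨γ, hγ⟩ := hu T (𝟙 _)
    obtain ⟨γ', hγ'⟩ := hu T' g
    refine ⟨Groupoid.inv γ ≫ γ', ?_⟩
    have h : Groupoid.inv ((unglue P).functor.map γ) = u := by
      rw [Groupoid.inv_eq_inv]
      exact IsIso.inv_eq_of_inv_hom_id hγ
    rw [Functor.map_comp, Groupoid.inv_eq_inv, Functor.map_inv, ← Groupoid.inv_eq_inv, h]
    exact hγ'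
  have : (unglue P).functor.EssSurj := by
    refine ⟨fun X => ?_⟩
    obtain ⟨G, u, _⟩ := exists_universal_grafting hP X
    exact ⟨G, ⟨(Groupoid.isoEquivHom _ _).symm (Groupoid.inv u)⟩⟩
  exact { }

end

end GrpdPoly

end

theorem mainTheorem6 {I : Type u} [Groupoid.{v} I]
    (P : GrpdPoly.PolyEndo.{u, v} I) (hP : P.HasFiniteDiscreteFibres) :
    ∃ a : GrpdPoly.SliceHom (P.obj (GrpdPoly.deadTrees P)) (GrpdPoly.deadTrees P),
      GrpdPoly.Alg.IsFixpoint (⟨GrpdPoly.deadTrees P, a⟩ : GrpdPoly.Alg P) ∧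
      GrpdPoly.Alg.IsHomotopyInitial.{u, v, max u v 1, v, x, x'}
        (⟨GrpdPoly.deadTrees P, a⟩ : GrpdPoly.Alg P) := by
  have := GrpdPoly.isEquivalence_unglue hP
  exact ⟨(GrpdPoly.unglue P).inverse,
    inferInstanceAs (GrpdPoly.unglue P).functor.inv.IsEquivalence,
    GrpdPoly.isHomotopyInitial_inverse GrpdPoly.exists_level_unglue⟩
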